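/- Let $I\subseteq\mathbb{R}$ be a nonempty open interval, let $m\ge 1$, and let $Ly=y^{(2m)}+a_{2m-1}y^{(2m-1)}+\dots+a_0y$ be a linear differential operator of even order $2m$ on $I$ with smooth complex-valued coefficients $a_i$. Let $V_L$ be the complex vector space of solutions $y\colon I\to\mathbb{C}$ of $Ly=0$, and let $L^*y=y^{(2m)}+\sum_{i=0}^{2m-1}(-1)^i(a_iy)^{(i)}$ be the formal adjoint of $L$. Suppose that $L$ is equivalent to its adjoint: there is a nowhere-vanishing smooth function $\mu\colon I\to\mathbb{C}$ with $\mu\,L^*y=L(\mu y)$ for all smooth $y\colon I\to\mathbb{C}$. For $f_1,\dots,f_m\in V_L$ let $\mathrm{Wr}(f_1,\dots,f_m)=\det\bigl(f_i^{(j-1)}\bigr)_{i,j=1}^m$ be their Wronskian, a function on $I$. Then: (1) The Wronskian of linearly independent $f_1,\dots,f_m\in V_L$ does not vanish identically, so that $\mathrm{span}(f_1,\dots,f_m)\mapsto[\mathrm{Wr}(f_1,\dots,f_m)]$ is a well-defined map (the Wronski map) from the Grassmannian $\mathrm{Gr}_mV_L$ of $m$-dimensional subspaces of $V_L$ to the projective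 space of lines in the space of functions on $I$. (2) If $m\ge 2$, then the Wronski map has even degree over its image: there is an even number $d$ such that every point in some nonempty Zariski-open subset of the image has exactly $d$ preimages in $\mathrm{Gr}_mV_L$. (3) The space of functions on $I$ spanned by the Wronskians of $m$ elements of $V_L$ is finite-dimensional, of dimension at most $\binom{2m}{m}-\binom{2m-2}{m-2}$ (where $\binom{0}{-1}=0$ when $m=1$). -/

import Mathlib

open scoped ContDiff

noncomputable section

/-- A linear differential operator `y⁽ⁿ⁾ + aₙ₋₁ y⁽ⁿ⁻¹⁾ + ⋯ + a₀ y` of order `n` with leading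
coefficient `1` and smooth complex-valued coefficients on `I ⊆ ℝ` (`I` will be an open interval).
Only the values of the coefficients on `I` matter. -/
structure LinDiffOp (I : Set ℝ) (n : ℕ) where
  coeff : Fin n → ℝ → ℂ
  contDiffOn_coeff : ∀ i, ContDiffOn ℝ ∞ (coeff i) I

namespace LinDiffOp

variable {I : Set ℝ} {n : ℕ}

/-- The function `L y`. (Meaningful at points of `I`, for `y` of class `Cⁿ` on the open set `I`.) -/
def apply (L : LinDiffOp I n) (y : ℝ → ℂ) : ℝ → ℂ := fun t =>
  iteratedDeriv n y t + ∑ i : Fin n, L.coeff i t * iteratedDeriv i y t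

/-- The formal adjoint `L* y = ∑_{i ≤ n} (-1)ⁱ (aᵢ y)⁽ⁱ⁾`, where `aₙ = 1`. -/
def adjointApply (L : LinDiffOp I n) (y : ℝ → ℂ) : ℝ → ℂ := fun t =>
  (-1) ^ n * iteratedDeriv n y t
    + ∑ i : Fin n, (-1) ^ (i : ℕ) * iteratedDeriv i (fun s => L.coeff i s * y s) t

/-- `P` and `Q` are equivalent operators on functions on `I`: there is a nowhere-vanishing
(smooth) function `μ` on `I` such that `μ · Q y = P (μ y)` on `I` for all smooth functions `y`. -/
def Equivalent (I : Set ℝ) (P Q : (ℝ → ℂ) → (ℝ → ℂ)) : Prop :=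
  ∃ μ : ℝ → ℂ, ContDiffOn ℝ ∞ μ I ∧ (∀ t ∈ I, μ t ≠ 0) ∧
    ∀ y : ℝ → ℂ, ContDiffOn ℝ ∞ y I →
      ∀ t ∈ I, μ t * Q y t = P (fun s => μ s * y s) t

/-- The operator `L` is equivalent to its formal adjoint. -/
def EquivalentToAdjoint (L : LinDiffOp I n) : Prop :=
  Equivalent I L.apply L.adjointApply

/-- The complex vector space `V_L` of (classical) solutions on the open set `I` of `L y = 0`.
A function on `I` is represented by its extension by zero to the real line. -/
def solutionSpace (L : LinDiffOp I n) (hI : IsOpen I) : Submodule ℂ (ℝ → ℂ) where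
  carrier := {y | ContDiffOn ℝ n y I ∧ (∀ t ∈ I, L.apply y t = 0) ∧ ∀ t ∉ I, y t = 0}
  zero_mem' := by
    refine ⟨contDiffOn_const, fun t _ => ?_, fun t _ => rfl⟩
    have h0 : ∀ k : ℕ, iteratedDeriv k (0 : ℝ → ℂ) t = 0 := fun k => by
      have : (0 : ℝ → ℂ) = fun _ => (0 : ℂ) := rfl
      rw [this, iteratedDeriv_const]; simp
    simp [apply, h0]
  add_mem' := by
    rintro y z ⟨hy, hy1, hy2⟩ ⟨hz, hz1, hz2⟩
    refine ⟨hy.add hz, fun t ht => ?_, fun t ht => by simp [hy2 t ht, hz2 t ht]⟩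
    have hyt : ContDiffAt ℝ n y t := hy.contDiffAt (hI.mem_nhds ht)
    have hzt : ContDiffAt ℝ n z t := hz.contDiffAt (hI.mem_nhds ht)
    have hadd : ∀ k : ℕ, k ≤ n →
        iteratedDeriv k (y + z) t = iteratedDeriv k y t + iteratedDeriv k z t := fun k hk =>
      iteratedDeriv_add (hyt.of_le (by exact_mod_cast hk)) (hzt.of_le (by exact_mod_cast hk))
    have h1 := hy1 t ht
    have h2 := hz1 t ht
    simp only [apply] at h1 h2 ⊢
    rw [hadd n le_rfl, Finset.sum_congr rfl fun i _ => by rw [hadd i i.2.le, mul_add],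
      Finset.sum_add_distrib]
    linear_combination h1 + h2
  smul_mem' := by
    rintro c y ⟨hy, hy1, hy2⟩
    refine ⟨contDiffOn_const.smul hy, fun t ht => ?_, fun t ht => by simp [hy2 t ht]⟩
    have hyt : ContDiffAt ℝ n y t := hy.contDiffAt (hI.mem_nhds ht)
    have hsmul : ∀ k : ℕ, k ≤ n →
        iteratedDeriv k (c • y) t = c * iteratedDeriv k y t := fun k hk => by
      rw [iteratedDeriv_const_smul (hyt.of_le (by exact_mod_cast hk)) c, smul_eq_mul]
    have h1 := hy1 t ht
    simp only [apply] at h1 ⊢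
    rw [hsmul n le_rfl, Finset.sum_congr rfl fun i _ => by rw [hsmul i i.2.le, mul_left_comm],
      ← Finset.mul_sum]
    linear_combination c * h1

end LinDiffOp

/-- The Wronskian of `f₁, …, f_m`, as a function on `I`. -/
def wronskian (I : Set ℝ) {m : ℕ} (f : Fin m → ℝ → ℂ) : I → ℂ := fun t =>
  Matrix.det (Matrix.of fun i j : Fin m => iteratedDeriv (j : ℕ) (f i) (t : ℝ))

/-- The Grassmannian of `m`-dimensional linear subspaces of `V`. -/
def Grassmannian (m : ℕ) (V : Type*) [AddCommGroup V] [Module ℂ V] : Type _ :=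
  {H : Submodule ℂ V // Module.finrank ℂ H = m}

/-- The space of functions on `I` spanned by the Wronskians of `m` elements of `V`. -/
def wronskianSpan (I : Set ℝ) (m : ℕ) (V : Submodule ℂ (ℝ → ℂ)) : Submodule ℂ (I → ℂ) :=
  Submodule.span ℂ (Set.range fun f : Fin m → V => wronskian I fun i => (f i : ℝ → ℂ))

/-- The Wronski map: it sends an `m`-dimensional `H ⊆ V` to the linear subspace of the space of
functions on `I` spanned by the Wronskians of the bases of `H`. As these Wronskians are scalar
multiples of each other, this is a point of the projective space of lines in `I → ℂ`
as soon as it is nonzero. -/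
def wronskiMap (I : Set ℝ) (m : ℕ) (V : Submodule ℂ (ℝ → ℂ)) (H : Grassmannian m V) :
    Submodule ℂ (I → ℂ) :=
  Submodule.span ℂ {w | ∃ f : Fin m → V, Submodule.span ℂ (Set.range f) = H.1 ∧
    w = wronskian I fun i => (f i : ℝ → ℂ)}

/-- `φ : X → ℙ(T → ℂ)` (points of projective space being lines in `T → ℂ`) has degree `d` over its
image: a general point of the image has exactly `d` preimages, that is, all points in some nonempty
Zariski-open subset of the image have. It is enough to consider basic open sets `P ≠ 0`, where `P`
is a homogeneous polynomial in the coordinates `g ↦ g t`, `t ∈ T`; on a finite-dimensional subspace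
of `T → ℂ` these give all polynomial functions. When the image is irreducible (as for a morphism
from a Grassmannian), `d` is unique. Since `encard` is used, the fibres concerned are finite. -/
def HasDegreeOverImage {X T : Type*} (φ : X → Submodule ℂ (T → ℂ)) (d : ℕ) : Prop :=
  ∃ (P : MvPolynomial T ℂ) (k : ℕ), P.IsHomogeneous k ∧
    (∃ x, ∃ g ∈ φ x, MvPolynomial.eval g P ≠ 0) ∧
    ∀ x, (∃ g ∈ φ x, MvPolynomial.eval g P ≠ 0) → {x' | φ x' = φ x}.encard = d

end

/-! Lagrange's identity exhibits `w · L v − L* w · v` as the derivative of a bilinear concomitant in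
the derivatives of `w` and `v`. If `u` and `v` solve `L`, then `μ⁻¹ u` solves the adjoint equation,
so the concomitant of `μ⁻¹ u` and `v` is constant on `I`. Its antisymmetrization `Ω` is a symplectic
form on the `2m`-dimensional solution space, and for every `t` the solutions vanishing to order `m`
at `t` form a Lagrangian subspace `E_t`. Take a symplectic basis `x_i, e_i` with the `e_i` spanning
`E_{t₀}`, and let `A`, `B` be the matrices of `m`-jets of the `x_i` and the `e_i` at `t`. On the
dense set where `det A ≠ 0`, one has `B = S A`; as `E_t` is Lagrangian, `S` is symmetric. The
dimension bound and the parity both come from this symmetry.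

Dimension: contracting a Wronskian with the symplectic bivector gives zero, that is, `∑ₐ Wr(…, x_a,
…, e_a, …) = 0`. For a fixed `p` this eliminates all Wronskians of basis vectors involving both
`x_p` and `e_p`, and counting subsets gives the bound.

Degree: in the chart of subspaces spanned by `x_i + ∑ Z_ij e_j`, the Wronskian is `det (A + Z B) =
det (1 + Z S) det A`, which is invariant under transposing `Z`. Transposition thus acts on the
fibres, and for `m ≥ 2` it has no fixed points over a general point of the image. The fibres have
constant finite cardinality over a nonempty open set because the chart is finite over its image:
linearly independent solutions have nonzero Wronskian, so the Wronski map has no base points, and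
the valuative criterion makes the entries of `Z` integral over the Wronskian coordinates. The chart
is the full preimage of the condition that the Wronskian be nonzero at `t₀`, so no other subspaces
enter these fibres.

The nonvanishing of Wronskians rests on existence and uniqueness for linear equations: a vanishing
Wronskian forces a linear relation on a subinterval, which for solutions of `L` spreads to all of
`I`. -/

noncomputable section

/-! ### Global existence and uniqueness for linear differential equations -/

section LinearODE

variable {E : Type*} [NormedAddCommGroup E] [NormedSpace ℝ E]

/-- Two-sided Grönwall bound. -/
theorem norm_le_mul_exp_of_norm_deriv_le {u u' : ℝ → E} {K a b t₀ : ℝ}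
    (ht₀ : t₀ ∈ Set.Icc a b)
    (hu : ∀ t ∈ Set.Icc a b, HasDerivWithinAt u (u' t) (Set.Icc a b) t)
    (hb : ∀ t ∈ Set.Icc a b, ‖u' t‖ ≤ K * ‖u t‖) :
    ∀ t ∈ Set.Icc a b, ‖u t‖ ≤ ‖u t₀‖ * Real.exp (K * |t - t₀|) := by
  intro t ht
  have hc : ContinuousOn u (Set.Icc a b) := fun s hs => (hu s hs).continuousWithinAt
  rcases le_total t₀ t with h | h
  · have hsub : Set.Icc t₀ t ⊆ Set.Icc a b := Set.Icc_subset_Icc ht₀.1 ht.2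
    have := norm_le_gronwallBound_of_norm_deriv_right_le (f := u) (f' := u') (K := K) (ε := 0)
      (a := t₀) (b := t) (δ := ‖u t₀‖) (hc.mono hsub)
      (fun x hx => (hu x (hsub (Set.Ico_subset_Icc_self hx))).mono_of_mem_nhdsWithin
        (Filter.mem_of_superset (Icc_mem_nhdsGE hx.2)
          (Set.Icc_subset_Icc (ht₀.1.trans hx.1) ht.2))) le_rfl
      (fun x hx => by simpa using hb x (hsub (Set.Ico_subset_Icc_self hx))) t ⟨h, le_rfl⟩
    rwa [gronwallBound_ε0, ← abs_of_nonneg (sub_nonneg.2 h)] at this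
  · have hneg : ∀ x ∈ Set.Icc (-t₀) (-t), -x ∈ Set.Icc a b := fun x hx =>
      ⟨by linarith [hx.2, ht.1], by linarith [hx.1, ht₀.2]⟩
    have hd : ∀ x ∈ Set.Ico (-t₀) (-t),
        HasDerivWithinAt (fun x => u (-x)) (-(u' (-x))) (Set.Ici x) x := by
      intro x hx
      have h1 : HasDerivWithinAt u (u' (-x)) (Set.Iic (-x)) (-x) :=
        (hu _ (hneg x (Set.Ico_subset_Icc_self hx))).mono_of_mem_nhdsWithin
          (Filter.mem_of_superset (Icc_mem_nhdsLE (a := t) (by linarith [hx.2]))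
            (Set.Icc_subset_Icc ht.1 (by linarith [hx.1, ht₀.2])))
      have h2 := HasDerivWithinAt.scomp (t' := Set.Iic (-x)) (h := fun x : ℝ => -x) x h1
        (hasDerivAt_neg x).hasDerivWithinAt (s := Set.Ici x)
        (fun y hy => neg_le_neg (Set.mem_Ici.1 hy))
      simpa [Function.comp_def] using h2
    have := norm_le_gronwallBound_of_norm_deriv_right_le (f := fun x => u (-x))
      (f' := fun x => -(u' (-x))) (K := K) (ε := 0)
      (a := -t₀) (b := -t) (δ := ‖u t₀‖)
      (hc.comp continuous_neg.continuousOn hneg) hd (by simp)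
      (fun x hx => by simpa using hb _ (hneg x (Set.Ico_subset_Icc_self hx)))
      (-t) ⟨by linarith, le_rfl⟩
    rw [gronwallBound_ε0] at this
    rw [abs_of_nonpos (sub_nonpos.2 h)]
    simpa [sub_eq_add_neg, add_comm] using this

theorem exists_norm_le_of_continuousOn_Icc {A : ℝ → E →L[ℝ] E} {a b : ℝ}
    (hA : ContinuousOn A (Set.Icc a b)) : ∃ K : ℝ, 0 ≤ K ∧ ∀ t ∈ Set.Icc a b, ‖A t‖ ≤ K := by
  obtain ⟨K, hK⟩ := isCompact_Icc.exists_bound_of_continuousOn hA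
  exact ⟨max K 0, le_max_right _ _, fun t ht => (hK t ht).trans (le_max_left _ _)⟩

/-- In an open interval, any two points lie in the interior of a compact subinterval. -/
theorem exists_Icc_subset_of_isOpen {I : Set ℝ} (hI : IsOpen I) (hc : I.OrdConnected) {s t : ℝ}
    (hs : s ∈ I) (ht : t ∈ I) :
    ∃ a b, s ∈ Set.Ioo a b ∧ t ∈ Set.Ioo a b ∧ Set.Icc a b ⊆ I := by
  have key : ∀ x ∈ I, ∃ ε > 0, x - ε ∈ I ∧ x + ε ∈ I := by
    intro x hx
    obtain ⟨ε, hε, h⟩ := Metric.isOpen_iff.1 hI x hx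
    refine ⟨ε / 2, by positivity, h ?_, h ?_⟩ <;>
      simp [Metric.mem_ball, abs_of_pos hε] <;> linarith
  obtain ⟨ε, hε, h1, h2⟩ := key s hs
  obtain ⟨δ, hδ, h3, h4⟩ := key t ht
  rcases le_total (s - ε) (t - δ) with h | h <;> rcases le_total (s + ε) (t + δ) with h' | h'
  · exact ⟨s - ε, t + δ, ⟨by linarith, by linarith⟩, ⟨by linarith, by linarith⟩, hc.out h1 h4⟩
  · exact ⟨s - ε, s + ε, ⟨by linarith, by linarith⟩, ⟨by linarith, by linarith⟩, hc.out h1 h2⟩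
  · exact ⟨t - δ, t + δ, ⟨by linarith, by linarith⟩, ⟨by linarith, by linarith⟩, hc.out h3 h4⟩
  · exact ⟨t - δ, s + ε, ⟨by linarith, by linarith⟩, ⟨by linarith, by linarith⟩, hc.out h3 h2⟩

/-- The Grönwall bound with zero initial value, on a compact subinterval containing both points,
where `A` is bounded. -/
theorem eq_zero_of_linearODE {I : Set ℝ} (hI : IsOpen I) (hc : I.OrdConnected)
    {A : ℝ → E →L[ℝ] E} (hA : ContinuousOn A I) {u : ℝ → E}
    (hu : ∀ t ∈ I, HasDerivAt u (A t (u t)) t) {t₀ : ℝ} (ht₀ : t₀ ∈ I) (h0 : u t₀ = 0) :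
    ∀ t ∈ I, u t = 0 := by
  intro t ht
  obtain ⟨a, b, h1, h2, hsub⟩ := exists_Icc_subset_of_isOpen hI hc ht₀ ht
  obtain ⟨K, hK0, hK⟩ := exists_norm_le_of_continuousOn_Icc (hA.mono hsub)
  have := norm_le_mul_exp_of_norm_deriv_le (Set.Ioo_subset_Icc_self h1)
    (fun s hs => (hu s (hsub hs)).hasDerivWithinAt)
    (fun s hs => (A s).le_of_opNorm_le (hK s hs) _) t (Set.Ioo_subset_Icc_self h2)
  rw [h0] at this
  simpa using this

/-- A bounded Lipschitz retraction that is the identity on the ball of radius `R`. -/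
theorem exists_lipschitz_truncation (R : ℝ) (hR : 0 < R) :
    ∃ ρ : E → E, LipschitzWith 3 ρ ∧ (∀ x, ‖ρ x‖ ≤ ‖x‖) ∧ (∀ x, ‖ρ x‖ ≤ 2 * R) ∧
      ∀ x, ‖x‖ ≤ R → ρ x = x := by
  let θ : ℝ → ℝ := fun s => max 0 (min 1 (2 - s / R))
  have hθ0 : ∀ s, 0 ≤ θ s := fun s => le_max_left _ _
  have hθ1 : ∀ s, θ s ≤ 1 := fun s => max_le zero_le_one (min_le_left _ _)
  have hθ2 : ∀ s, 2 * R ≤ s → θ s = 0 := fun s hs => by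
    have : 2 ≤ s / R := by rwa [le_div_iff₀ hR]
    exact max_eq_left ((min_le_right _ _).trans (by linarith))
  have hθl : ∀ s s', |θ s - θ s'| ≤ |s - s'| / R := fun s s' => by
    have h1 : |θ s - θ s'| ≤ |min 1 (2 - s / R) - min 1 (2 - s' / R)| := by
      simpa [θ, max_comm] using
        abs_max_sub_max_le_abs (min 1 (2 - s / R)) (min 1 (2 - s' / R)) 0
    have h2 : |min 1 (2 - s / R) - min 1 (2 - s' / R)| ≤ |(2 - s / R) - (2 - s' / R)| := by
      have := abs_min_sub_min_le_max 1 (2 - s / R) 1 (2 - s' / R)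
      simpa using this
    refine (h1.trans h2).trans (le_of_eq ?_)
    rw [show (2 - s / R) - (2 - s' / R) = -((s - s') / R) by ring, abs_neg, abs_div,
      abs_of_pos hR]
  -- The constant `3` is `1 + 2`: the cutoff is at most `1`, and it is `1/R`-Lipschitz while `y` has
  -- norm at most `2R`.
  have hs : ∀ x y : E, ‖y‖ ≤ 2 * R → ‖θ ‖x‖ • x - θ ‖y‖ • y‖ ≤ 3 * ‖x - y‖ := by
    intro x y hy
    have e : θ ‖x‖ • x - θ ‖y‖ • y = θ ‖x‖ • (x - y) + (θ ‖x‖ - θ ‖y‖) • y := by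
      rw [smul_sub, sub_smul]; abel
    rw [e]
    refine (norm_add_le _ _).trans ?_
    rw [norm_smul, norm_smul, Real.norm_eq_abs, Real.norm_eq_abs, abs_of_nonneg (hθ0 _)]
    have h1 : θ ‖x‖ * ‖x - y‖ ≤ 1 * ‖x - y‖ := by gcongr; exact hθ1 _
    have h2 : |θ ‖x‖ - θ ‖y‖| * ‖y‖ ≤ (‖x - y‖ / R) * (2 * R) := by
      gcongr
      exact (hθl _ _).trans (by gcongr; exact abs_norm_sub_norm_le _ _)
    have h3 : (‖x - y‖ / R) * (2 * R) = 2 * ‖x - y‖ := by field_simp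
    linarith
  refine ⟨fun x => θ ‖x‖ • x, LipschitzWith.of_dist_le_mul fun x y => ?_, fun x => ?_,
    fun x => ?_, fun x hx => ?_⟩
  · rw [dist_eq_norm, dist_eq_norm]
    rcases le_total ‖y‖ (2 * R) with hy | hy
    · exact hs x y hy
    · rcases le_total ‖x‖ (2 * R) with hx | hx
      · rw [norm_sub_rev, norm_sub_rev x]; exact hs y x hx
      · simp [hθ2 _ hx, hθ2 _ hy]
  · rw [norm_smul, Real.norm_eq_abs, abs_of_nonneg (hθ0 _)]
    exact mul_le_of_le_one_left (norm_nonneg _) (hθ1 _)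
  · rcases le_total ‖x‖ (2 * R) with hx | hx
    · rw [norm_smul, Real.norm_eq_abs, abs_of_nonneg (hθ0 _)]
      exact (mul_le_of_le_one_left (norm_nonneg _) (hθ1 _)).trans hx
    · simp [hθ2 _ hx, hR.le]
  · have : θ ‖x‖ = 1 := by
      have : ‖x‖ / R ≤ 1 := by rwa [div_le_one hR]
      simp only [θ]
      rw [min_eq_left (by linarith), max_eq_right zero_le_one]
    simp [this]

/-- A linear field is unbounded, so Picard–Lindelöf alone gives only short-time solutions. After
truncation by `ρ` the field is bounded and the whole interval is covered; Grönwall then shows that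
the solution stays in the ball where `ρ` is the identity. -/
theorem exists_linearODE_Icc [CompleteSpace E] {A : ℝ → E →L[ℝ] E} {a b t₀ : ℝ}
    (hA : ContinuousOn A (Set.Icc a b)) (ht₀ : t₀ ∈ Set.Icc a b) (x₀ : E) :
    ∃ u : ℝ → E, u t₀ = x₀ ∧ ∀ t ∈ Set.Icc a b, HasDerivWithinAt u (A t (u t)) (Set.Icc a b) t := by
  obtain ⟨K, hK0, hK⟩ := exists_norm_le_of_continuousOn_Icc hA
  -- The a priori Grönwall bound over the whole interval; the `+ 1` keeps `R` positive when `x₀ =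
  -- 0`.
  set R : ℝ := ‖x₀‖ * Real.exp (K * (b - a)) + 1 with hRdef
  have hR : 0 < R := by positivity
  obtain ⟨ρ, hρl, hρ1, hρ2, hρ3⟩ := exists_lipschitz_truncation (E := E) R hR
  let L : NNReal := ⟨K * (2 * R), by positivity⟩
  let T : NNReal := ⟨max (b - t₀) (t₀ - a), le_max_of_le_left (sub_nonneg.2 ht₀.2)⟩
  have hPL : IsPicardLindelof (fun t x => A t (ρ x)) (⟨t₀, ht₀⟩ : Set.Icc a b) x₀ (L * T) 0 L
      (⟨K, hK0⟩ * 3) :=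
    { lipschitzOnWith := fun t ht => by
        refine (LipschitzWith.comp (Kf := ⟨K, hK0⟩) (f := A t) ?_ hρl).lipschitzOnWith
        exact (A t).lipschitz.weaken (hK t ht)
      continuousOn := fun x _ => hA.clm_apply continuousOn_const
      norm_le := fun t ht x _ =>
        ((A t).le_of_opNorm_le (hK t ht) _).trans (mul_le_mul_of_nonneg_left (hρ2 x) hK0)
      mul_max_le := by rw [NNReal.coe_mul, NNReal.coe_zero, sub_zero]; exact le_rfl }
  obtain ⟨u, hu0, hu⟩ := hPL.exists_eq_forall_mem_Icc_hasDerivWithinAt₀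
  refine ⟨u, hu0, fun t ht => ?_⟩
  have hb := norm_le_mul_exp_of_norm_deriv_le ht₀ hu
    (fun s hs => ((A s).le_of_opNorm_le (hK s hs) _).trans
      (mul_le_mul_of_nonneg_left (hρ1 _) hK0)) t ht
  have hbR : ‖u t‖ ≤ R := by
    refine hb.trans ?_
    simp only at hu0
    rw [hu0, hRdef]
    have : |t - t₀| ≤ b - a := by
      rw [abs_le]; constructor <;> linarith [ht.1, ht.2, ht₀.1, ht₀.2]
    have : ‖x₀‖ * Real.exp (K * |t - t₀|) ≤ ‖x₀‖ * Real.exp (K * (b - a)) := by gcongr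
    linarith
  have := hu t ht
  rwa [hρ3 _ hbR] at this

theorem exists_linearODE [CompleteSpace E] {I : Set ℝ} (hI : IsOpen I) (hc : I.OrdConnected)
    {A : ℝ → E →L[ℝ] E} (hA : ContinuousOn A I) {t₀ : ℝ} (ht₀ : t₀ ∈ I) (x₀ : E) :
    ∃ u : ℝ → E, u t₀ = x₀ ∧ ∀ t ∈ I, HasDerivAt u (A t (u t)) t := by
  have key : ∀ t : ℝ, ∃ a b : ℝ, ∃ u : ℝ → E, t ∈ I → (t₀ ∈ Set.Ioo a b ∧ t ∈ Set.Ioo a b ∧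
      Set.Icc a b ⊆ I ∧ u t₀ = x₀ ∧ ∀ s ∈ Set.Ioo a b, HasDerivAt u (A s (u s)) s) := by
    intro t
    by_cases ht : t ∈ I
    · obtain ⟨a, b, h1, h2, hsub⟩ := exists_Icc_subset_of_isOpen hI hc ht₀ ht
      obtain ⟨u, hu0, hu⟩ := exists_linearODE_Icc (hA.mono hsub) (Set.Ioo_subset_Icc_self h1) x₀
      exact ⟨a, b, u, fun _ => ⟨h1, h2, hsub, hu0, fun s hs =>
        (hu s (Set.Ioo_subset_Icc_self hs)).hasDerivAt (Icc_mem_nhds hs.1 hs.2)⟩⟩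
    · exact ⟨0, 0, 0, fun h => absurd h ht⟩
  choose a b u hu using key
  -- Uniqueness on the intersection of the two intervals, which contains `t₀`. It makes the diagonal
  -- `t ↦ u t t` a well-glued global solution.
  have agree : ∀ t ∈ I, ∀ s ∈ I, s ∈ Set.Ioo (a t) (b t) → u s s = u t s := by
    intro t ht s hs hst
    obtain ⟨h1, h2, hsub, h3, h4⟩ := hu t ht
    obtain ⟨h1', h2', hsub', h3', h4'⟩ := hu s hs
    have := eq_zero_of_linearODE (I := Set.Ioo (a t) (b t) ∩ Set.Ioo (a s) (b s))
      (isOpen_Ioo.inter isOpen_Ioo) (Set.ordConnected_Ioo.inter Set.ordConnected_Ioo)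
      (A := A) (hA.mono fun x hx => hsub (Set.Ioo_subset_Icc_self hx.1)) (u := fun x => u s x - u t x)
      (fun x hx => by
        rw [map_sub]
        exact (h4' x hx.2).sub (h4 x hx.1)) ⟨h1, h1'⟩ (by simp [h3, h3']) s ⟨hst, h2'⟩
    exact sub_eq_zero.1 this
  refine ⟨fun t => u t t, (hu t₀ ht₀).2.2.2.1, fun t ht => ?_⟩
  obtain ⟨h1, h2, hsub, h3, h4⟩ := hu t ht
  refine (h4 t h2).congr_of_eventuallyEq ?_
  filter_upwards [isOpen_Ioo.mem_nhds h2] with s hs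
  exact agree t ht s (hsub (Set.Ioo_subset_Icc_self hs)) hs

end LinearODE


/-! ### Scalar equations as first-order systems -/

section Companion

variable {n : ℕ} {I : Set ℝ}

/-- The companion matrix of `y⁽ⁿ⁾ + ∑ cᵢ y⁽ⁱ⁾`, as a real-linear endomorphism of `ℂⁿ`. -/
def companion (c : Fin n → ℂ) : (Fin n → ℂ) →L[ℝ] (Fin n → ℂ) :=
  LinearMap.toContinuousLinearMap
    { toFun := fun x i => if h : (i : ℕ) + 1 < n then x ⟨i + 1, h⟩ else -∑ j, c j * x j
      map_add' := fun x y => by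
        ext i
        by_cases h : (i : ℕ) + 1 < n
        · simp [h]
        · simp only [h, dite_false, Pi.add_apply, mul_add, Finset.sum_add_distrib]
          ring
      map_smul' := fun r x => by
        ext i
        by_cases h : (i : ℕ) + 1 < n
        · simp [h]
        · simp only [h, dite_false, Pi.smul_apply, RingHom.id_apply, smul_neg, Finset.smul_sum,
            mul_smul_comm] }

theorem companion_apply (c : Fin n → ℂ) (x : Fin n → ℂ) (i : Fin n) :
    companion c x i = if h : (i : ℕ) + 1 < n then x ⟨i + 1, h⟩ else -∑ j, c j * x j := rfl

theorem contDiffOn_companion {k : WithTop ℕ∞} {a : Fin n → ℝ → ℂ}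
    (ha : ∀ i, ContDiffOn ℝ k (a i) I) :
    ContDiffOn ℝ k (fun t => companion fun i => a i t) I := by
  rw [contDiffOn_clm_apply]
  intro x
  rw [contDiffOn_pi]
  intro i
  simp only [companion_apply]
  by_cases h : (i : ℕ) + 1 < n
  · simp only [h, dite_true]
    exact contDiffOn_const
  · simp only [h, dite_false]
    exact (ContDiffOn.sum fun j _ => (ha j).mul contDiffOn_const).neg

theorem ContDiffOn.hasDerivAt_iteratedDeriv {y : ℝ → ℂ} {k : WithTop ℕ∞} (hI : IsOpen I)
    (hy : ContDiffOn ℝ k y I) {j : ℕ} (hj : ((j + 1 : ℕ) : WithTop ℕ∞) ≤ k) {t : ℝ} (ht : t ∈ I) :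
    HasDerivAt (iteratedDeriv j y) (iteratedDeriv (j + 1) y t) t := by
  have h1 : DifferentiableOn ℝ (iteratedDerivWithin j y I) I :=
    hy.differentiableOn_iteratedDerivWithin
      (lt_of_lt_of_le (by exact_mod_cast Nat.lt_succ_self j) hj) hI.uniqueDiffOn
  have h2 : DifferentiableAt ℝ (iteratedDeriv j y) t := by
    refine ((h1 t ht).differentiableAt (hI.mem_nhds ht)).congr_of_eventuallyEq ?_
    filter_upwards [hI.mem_nhds ht] with s hs
    exact (iteratedDerivWithin_of_isOpen hI hs).symm
  rw [iteratedDeriv_succ]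
  exact h2.hasDerivAt

theorem ContDiffOn.continuousOn_iteratedDeriv {y : ℝ → ℂ} {k : WithTop ℕ∞} (hI : IsOpen I)
    (hy : ContDiffOn ℝ k y I) {j : ℕ} (hj : ((j + 1 : ℕ) : WithTop ℕ∞) ≤ k) :
    ContinuousOn (iteratedDeriv j y) I := fun _ ht =>
  (hy.hasDerivAt_iteratedDeriv hI hj ht).continuousAt.continuousWithinAt

/-- The vector of the derivatives of order less than `n`. -/
def jet (n : ℕ) (y : ℝ → ℂ) (t : ℝ) : Fin n → ℂ := fun j => iteratedDeriv j y t

theorem hasDerivAt_jet (hI : IsOpen I) {a : Fin n → ℝ → ℂ} {y : ℝ → ℂ}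
    (hy : ContDiffOn ℝ n y I)
    (hL : ∀ t ∈ I, iteratedDeriv n y t + ∑ i : Fin n, a i t * iteratedDeriv i y t = 0)
    {t : ℝ} (ht : t ∈ I) :
    HasDerivAt (jet n y) (companion (fun i => a i t) (jet n y t)) t := by
  rw [hasDerivAt_pi]
  intro i
  have h := hy.hasDerivAt_iteratedDeriv hI (j := i) (by exact_mod_cast i.2) ht
  have e : companion (fun i => a i t) (jet n y t) i = iteratedDeriv (i + 1) y t := by
    rw [companion_apply]
    split_ifs with h'
    · rfl
    · have : (i : ℕ) + 1 = n := by omega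
      rw [this]
      simp only [jet]
      linear_combination -hL t ht
  rw [e]
  exact h

theorem eq_zero_of_jet_eq_zero (hI : IsOpen I) (hc : I.OrdConnected) {a : Fin n → ℝ → ℂ}
    (ha : ∀ i, ContinuousOn (a i) I) {y : ℝ → ℂ} (hy : ContDiffOn ℝ n y I)
    (hL : ∀ t ∈ I, iteratedDeriv n y t + ∑ i : Fin n, a i t * iteratedDeriv i y t = 0)
    {t₀ : ℝ} (ht₀ : t₀ ∈ I) (h0 : jet n y t₀ = 0) : ∀ t ∈ I, y t = 0 := by
  intro t ht
  rcases Nat.eq_zero_or_pos n with rfl | hn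
  · simpa using hL t ht
  · have hA : ContinuousOn (fun t => companion fun i => a i t) I :=
      contDiffOn_zero.1 (contDiffOn_companion fun i => contDiffOn_zero.2 (ha i))
    have := eq_zero_of_linearODE hI hc hA (fun s hs => hasDerivAt_jet hI hy hL hs) ht₀ h0 t ht
    simpa [jet] using congrFun this ⟨0, hn⟩

/-- Bootstrapping: if `u` is `Cᵏ`, so is `A u = u'`, hence `u` is `Cᵏ⁺¹`. -/
theorem contDiffOn_of_linearODE {E : Type*} [NormedAddCommGroup E] [NormedSpace ℝ E]
    (hI : IsOpen I) {A : ℝ → E →L[ℝ] E} (hA : ContDiffOn ℝ ∞ A I) {u : ℝ → E}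
    (hu : ∀ t ∈ I, HasDerivAt u (A t (u t)) t) : ContDiffOn ℝ ∞ u I := by
  rw [contDiffOn_infty]
  intro k
  induction k with
  | zero =>
    exact contDiffOn_zero.2 fun t ht => (hu t ht).continuousAt.continuousWithinAt
  | succ k ih =>
    have := (contDiffOn_succ_iff_deriv_of_isOpen (n := (k : WithTop ℕ∞)) (f := u) hI).2
      ⟨fun t ht => (hu t ht).differentiableAt.differentiableWithinAt, by simp, ?_⟩
    · exact_mod_cast this
    · have h1 : ContDiffOn ℝ k (fun t => A t (u t)) I :=
        (hA.of_le (by exact_mod_cast le_top)).clm_apply ih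
      exact h1.congr fun t ht => (hu t ht).deriv

theorem iteratedDeriv_eq_of_companion (hI : IsOpen I) {a : Fin n → ℝ → ℂ} {u : ℝ → Fin n → ℂ}
    (hu : ∀ t ∈ I, HasDerivAt u (companion (fun i => a i t) (u t)) t) (hn : 0 < n)
    {y : ℝ → ℂ} (hy : ∀ t ∈ I, y t = u t ⟨0, hn⟩) (j : ℕ) (hj : j < n) :
    ∀ t ∈ I, iteratedDeriv j y t = u t ⟨j, hj⟩ := by
  induction j with
  | zero => simpa using hy
  | succ j ih =>
    intro t ht
    rw [iteratedDeriv_succ]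
    have h1 : HasDerivAt (fun s => u s ⟨j, by omega⟩) (u t ⟨j + 1, hj⟩) t := by
      have := (hasDerivAt_pi.1 (hu t ht)) ⟨j, by omega⟩
      rwa [companion_apply, dif_pos hj] at this
    refine (h1.congr_of_eventuallyEq ?_).deriv
    filter_upwards [hI.mem_nhds ht] with s hs
    exact ih (by omega) s hs

end Companion

/-! ### The solution space and its initial values -/

namespace LinDiffOp

variable {I : Set ℝ} {n : ℕ} (L : LinDiffOp I n) (hI : IsOpen I)

theorem contDiffOn_solution {y : ℝ → ℂ} (hy : y ∈ L.solutionSpace hI) : ContDiffOn ℝ ∞ y I := by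
  obtain ⟨h1, h2, h3⟩ := hy
  rcases Nat.eq_zero_or_pos n with rfl | hn
  · exact (contDiffOn_const (c := (0 : ℂ))).congr fun t ht => by simpa [apply] using h2 t ht
  · have := contDiffOn_of_linearODE hI (contDiffOn_companion L.contDiffOn_coeff)
      (u := jet n y) fun t ht => hasDerivAt_jet hI h1 h2 ht
    simpa [jet] using (contDiffOn_pi.1 this) ⟨0, hn⟩

/-- The vector of the first `k` derivatives at `t ∈ I`, as a linear map on the solution space. -/
def jetMap (k : ℕ) {t : ℝ} (ht : t ∈ I) : L.solutionSpace hI →ₗ[ℂ] (Fin k → ℂ) where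
  toFun y := jet k (y : ℝ → ℂ) t
  map_add' y z := by
    ext j
    exact iteratedDeriv_add
      (((L.contDiffOn_solution hI y.2).contDiffAt (hI.mem_nhds ht)).of_le
        (by exact_mod_cast le_top))
      (((L.contDiffOn_solution hI z.2).contDiffAt (hI.mem_nhds ht)).of_le
        (by exact_mod_cast le_top))
  map_smul' c y := by
    ext j
    exact iteratedDeriv_const_smul
      (((L.contDiffOn_solution hI y.2).contDiffAt (hI.mem_nhds ht)).of_le
        (by exact_mod_cast le_top)) c

theorem jetMap_apply (k : ℕ) {t : ℝ} (ht : t ∈ I) (y : L.solutionSpace hI) (j : Fin k) :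
    L.jetMap hI k ht y j = iteratedDeriv j (y : ℝ → ℂ) t := rfl

theorem solution_eq_zero (hc : I.OrdConnected) (y : L.solutionSpace hI) {t : ℝ} (ht : t ∈ I)
    (h0 : L.jetMap hI n ht y = 0) : y = 0 := by
  ext s
  by_cases hs : s ∈ I
  · exact eq_zero_of_jet_eq_zero hI hc (fun i => (L.contDiffOn_coeff i).continuousOn) y.2.1 y.2.2.1
      ht h0 s hs
  · exact y.2.2.2 s hs

theorem jetMap_injective (hc : I.OrdConnected) {t : ℝ} (ht : t ∈ I) :
    Function.Injective (L.jetMap hI n ht) := by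
  rw [injective_iff_map_eq_zero]
  exact fun y hy => L.solution_eq_zero hI hc y ht hy

theorem jetMap_surjective (hc : I.OrdConnected) {t : ℝ} (ht : t ∈ I) :
    Function.Surjective (L.jetMap hI n ht) := by
  classical
  intro x
  rcases Nat.eq_zero_or_pos n with hn | hn
  · subst hn
    exact ⟨0, Subsingleton.elim _ _⟩
  have hA := contDiffOn_companion (k := ∞) L.contDiffOn_coeff
  obtain ⟨u, hu0, hu⟩ := exists_linearODE hI hc hA.continuousOn ht x
  have hus := contDiffOn_of_linearODE hI hA hu
  -- Solutions are represented by their extension by zero, hence the indicator.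
  let y : ℝ → ℂ := I.indicator fun s => u s ⟨0, hn⟩
  have hy : ∀ s ∈ I, y s = u s ⟨0, hn⟩ := fun s hs => Set.indicator_of_mem hs _
  have hj := iteratedDeriv_eq_of_companion hI hu hn hy
  have hmem : y ∈ L.solutionSpace hI := by
    refine ⟨?_, fun s hs => ?_, fun s hs => Set.indicator_of_notMem hs _⟩
    · exact (((contDiffOn_pi.1 hus) ⟨0, hn⟩).congr hy).of_le (by exact_mod_cast le_top)
    · obtain ⟨k, rfl⟩ : ∃ k, n = k + 1 := ⟨n - 1, by omega⟩
      have h1 : HasDerivAt (fun s => u s ⟨k, by omega⟩) (-∑ i, L.coeff i s * u s i) s := by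
        have := (hasDerivAt_pi.1 (hu s hs)) ⟨k, by omega⟩
        rwa [companion_apply, dif_neg (by simp)] at this
      have h2 : iteratedDeriv (k + 1) y s = -∑ i, L.coeff i s * u s i := by
        rw [iteratedDeriv_succ]
        refine (h1.congr_of_eventuallyEq ?_).deriv
        filter_upwards [hI.mem_nhds hs] with r hr
        exact hj k (by omega) r hr
      simp only [apply]
      rw [h2, neg_add_eq_zero]
      exact Finset.sum_congr rfl fun i _ => by rw [hj i i.2 s hs]
  refine ⟨⟨y, hmem⟩, ?_⟩
  ext j
  rw [jetMap_apply, hj j j.2 t ht, hu0]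

/-- Solutions correspond to their initial values. -/
def jetEquiv (hc : I.OrdConnected) {t : ℝ} (ht : t ∈ I) :
    L.solutionSpace hI ≃ₗ[ℂ] (Fin n → ℂ) :=
  LinearEquiv.ofBijective (L.jetMap hI n ht)
    ⟨L.jetMap_injective hI hc ht, L.jetMap_surjective hI hc ht⟩

theorem finrank_solutionSpace (hc : I.OrdConnected) (hne : I.Nonempty) :
    Module.finrank ℂ (L.solutionSpace hI) = n := by
  obtain ⟨t, ht⟩ := hne
  rw [(L.jetEquiv hI hc ht).finrank_eq, Module.finrank_fin_fun]

theorem finiteDimensional_solutionSpace (hc : I.OrdConnected) (hne : I.Nonempty) :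
    FiniteDimensional ℂ (L.solutionSpace hI) := by
  obtain ⟨t, ht⟩ := hne
  exact (L.jetEquiv hI hc ht).symm.finiteDimensional

end LinDiffOp


/-! ### Vanishing Wronskians and linear dependence -/

section Wronskian

/-- The Wronskian of `f₁, …, f_k` at a point of the real line. -/
def wronskianAt {k : ℕ} (f : Fin k → ℝ → ℂ) (t : ℝ) : ℂ :=
  Matrix.det (Matrix.of fun i j : Fin k => iteratedDeriv (j : ℕ) (f i) t)

variable {J : Set ℝ}

theorem iteratedDeriv_linearCombination {ι : Type*} [Fintype ι] {f : ι → ℝ → ℂ} (hJ : IsOpen J)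
    (hf : ∀ i, ContDiffOn ℝ ∞ (f i) J) (c : ι → ℂ) (j : ℕ) {t : ℝ} (ht : t ∈ J) :
    iteratedDeriv j (fun s => ∑ i, c i * f i s) t = ∑ i, c i * iteratedDeriv j (f i) t := by
  have hfa : ∀ i, ContDiffAt ℝ j (f i) t := fun i =>
    ((hf i).contDiffAt (hJ.mem_nhds ht)).of_le (by exact_mod_cast le_top)
  rw [iteratedDeriv_fun_sum fun i _ => contDiffAt_const.mul (hfa i)]
  exact Finset.sum_congr rfl fun i _ => iteratedDeriv_const_mul_field _ _

theorem continuousOn_det_iteratedDeriv {k : ℕ} {f : Fin k → ℝ → ℂ} (hJ : IsOpen J)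
    (hf : ∀ i, ContDiffOn ℝ ∞ (f i) J) (e : Fin k → ℕ) :
    ContinuousOn (fun t => Matrix.det (Matrix.of fun i j : Fin k => iteratedDeriv (e j) (f i) t))
      J := by
  simp only [Matrix.det_apply, Matrix.of_apply]
  refine continuousOn_finsetSum _ fun σ _ => ContinuousOn.const_smul ?_ _
  exact continuousOn_finsetProd _ fun i _ =>
    (hf _).continuousOn_iteratedDeriv hJ (by exact_mod_cast le_top)

theorem continuousOn_wronskianAt {k : ℕ} {f : Fin k → ℝ → ℂ} (hJ : IsOpen J)
    (hf : ∀ i, ContDiffOn ℝ ∞ (f i) J) : ContinuousOn (wronskianAt f) J :=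
  continuousOn_det_iteratedDeriv hJ hf fun j => j

/-- The Wronskian, expanded along the last row. -/
theorem wronskianAt_snoc {k : ℕ} (f : Fin k → ℝ → ℂ) (g : ℝ → ℂ) (t : ℝ) :
    wronskianAt (Fin.snoc f g : Fin (k + 1) → ℝ → ℂ) t =
      ∑ j : Fin (k + 1), (-1) ^ (k + j : ℕ) * iteratedDeriv j g t *
        Matrix.det (Matrix.of fun i l : Fin k => iteratedDeriv (j.succAbove l : ℕ) (f i) t) := by
  rw [wronskianAt, Matrix.det_succ_row _ (Fin.last k)]
  refine Finset.sum_congr rfl fun j _ => ?_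
  congr 2
  · simp
  · ext i l
    simp

theorem wronskianAt_eq_zero_of_eq {k : ℕ} {f : Fin k → ℝ → ℂ} {i j : Fin k} (hij : i ≠ j)
    (h : f i = f j) (t : ℝ) : wronskianAt f t = 0 :=
  Matrix.det_zero_of_row_eq hij (by ext l; simp [h])

/-- If the Wronskian of smooth functions vanishes identically on an open interval, then the
functions are linearly dependent on some open subinterval. -/
theorem exists_linear_relation_of_wronskianAt_eq_zero (k : ℕ) :
    ∀ (J : Set ℝ), IsOpen J → J.OrdConnected → J.Nonempty → ∀ f : Fin k → ℝ → ℂ,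
      (∀ i, ContDiffOn ℝ ∞ (f i) J) → (∀ t ∈ J, wronskianAt f t = 0) →
      ∃ (J' : Set ℝ) (c : Fin k → ℂ), J' ⊆ J ∧ IsOpen J' ∧ J'.Nonempty ∧ c ≠ 0 ∧
        ∀ t ∈ J', ∑ i, c i * f i t = 0 := by
  induction k with
  | zero =>
    intro J _ _ ⟨t, ht⟩ f _ h0
    simpa [wronskianAt] using h0 t ht
  | succ k ih =>
    intro J hJ hc hne f hf h0
    obtain ⟨f₀, g, rfl⟩ : ∃ (f₀ : Fin k → ℝ → ℂ) (g : ℝ → ℂ), f = Fin.snoc f₀ g :=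
      ⟨Fin.init f, f (Fin.last k), (Fin.snoc_init_self f).symm⟩
    have hf₀ : ∀ i, ContDiffOn ℝ ∞ (f₀ i) J := fun i => by simpa using hf i.castSucc
    by_cases hW : ∀ t ∈ J, wronskianAt f₀ t = 0
    · obtain ⟨J', c, h1, ho, h2, h3, h4⟩ := ih J hJ hc hne f₀ hf₀ hW
      refine ⟨J', Fin.snoc c 0, h1, ho, h2, fun h => h3 ?_, fun t ht => ?_⟩
      · ext i
        simpa using congrFun h i.castSucc
      · rw [Fin.sum_univ_castSucc]
        simpa using h4 t ht
    · push Not at hW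
      obtain ⟨t₁, ht₁, hW⟩ := hW
      have hopen : ∃ ε > 0, Metric.ball t₁ ε ⊆ J ∧ ∀ t ∈ Metric.ball t₁ ε, wronskianAt f₀ t ≠ 0 := by
        have h1 := (continuousOn_wronskianAt hJ hf₀).continuousAt (hJ.mem_nhds ht₁)
        have h2 := (h1.eventually_ne hW).and (hJ.mem_nhds ht₁)
        obtain ⟨ε, hε, h⟩ := Metric.eventually_nhds_iff_ball.1 h2
        exact ⟨ε, hε, fun t ht => (h t ht).2, fun t ht => (h t ht).1⟩
      obtain ⟨ε, hε, hsub, hne0⟩ := hopen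
      set J' := Metric.ball t₁ ε
      let M : Matrix (Fin k) (Fin k) ℂ := Matrix.of fun i j => iteratedDeriv (j : ℕ) (f₀ i) t₁
      -- `y` is `g` minus the combination of the `f₀ i` that has the same `k`-jet as `g` at `t₁`; it
      -- exists because the Wronskian of `f₀` is nonzero there.
      let c : Fin (k + 1) → ℂ := Fin.snoc (-(Matrix.vecMul (jet k g t₁) M⁻¹)) 1
      let y : ℝ → ℂ := fun s => ∑ i, c i * (Fin.snoc f₀ g : Fin (k + 1) → ℝ → ℂ) i s
      have hjet : ∀ (j : ℕ), ∀ t ∈ J, iteratedDeriv j y t =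
          ∑ i, c i * iteratedDeriv j ((Fin.snoc f₀ g : Fin (k + 1) → ℝ → ℂ) i) t :=
        fun j t ht => iteratedDeriv_linearCombination hJ hf c j ht
      have hy : ContDiffOn ℝ ∞ y J := ContDiffOn.sum fun i _ => contDiffOn_const.mul (hf i)
      -- The Wronskian is linear in its last entry, and the combination defining `y` adds only terms
      -- with a repeated entry.
      have hWy : ∀ t ∈ J, wronskianAt (Fin.snoc f₀ y : Fin (k + 1) → ℝ → ℂ) t = 0 := by
        intro t ht
        have e : wronskianAt (Fin.snoc f₀ y : Fin (k + 1) → ℝ → ℂ) t = ∑ i, c i *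
            wronskianAt (Fin.snoc f₀ ((Fin.snoc f₀ g : Fin (k + 1) → ℝ → ℂ) i) :
              Fin (k + 1) → ℝ → ℂ) t := by
          simp only [wronskianAt_snoc, Finset.mul_sum]
          rw [Finset.sum_comm]
          refine Finset.sum_congr rfl fun j _ => ?_
          rw [hjet j t ht, Finset.mul_sum, Finset.sum_mul]
          exact Finset.sum_congr rfl fun i _ => by ring
        rw [e, Fin.sum_univ_castSucc]
        have h1 : ∀ i : Fin k, wronskianAt (Fin.snoc f₀ (f₀ i) : Fin (k + 1) → ℝ → ℂ) t = 0 :=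
          fun i => wronskianAt_eq_zero_of_eq (i := i.castSucc) (j := Fin.last k)
            (Fin.castSucc_lt_last i).ne (by simp) t
        simp only [Fin.snoc_castSucc, Fin.snoc_last, h1, h0 t ht, mul_zero, Finset.sum_const_zero,
          add_zero]
      let Mi : Fin (k + 1) → ℝ → ℂ := fun j t =>
        Matrix.det (Matrix.of fun i l : Fin k => iteratedDeriv (j.succAbove l : ℕ) (f₀ i) t)
      have hMlast : ∀ t, Mi (Fin.last k) t = wronskianAt f₀ t := fun t => by
        simp [Mi, wronskianAt]
      have hMc : ∀ j, ContinuousOn (Mi j) J := fun j =>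
        continuousOn_det_iteratedDeriv hJ hf₀ fun l => (j.succAbove l : ℕ)
      let a : Fin k → ℝ → ℂ := fun j t =>
        (-1) ^ (k + j : ℕ) * Mi j.castSucc t / wronskianAt f₀ t
      -- Expanding `Wr(f₀, y) = 0` along the row of `y` and dividing by `Wr(f₀)` gives a monic
      -- equation of order `k` for `y`. As its `k`-jet at `t₁` is zero, `y` vanishes on the ball.
      have hode : ∀ t ∈ J', iteratedDeriv k y t + ∑ i : Fin k, a i t * iteratedDeriv i y t = 0 := by
        intro t ht
        have h1 := hWy t (hsub ht)
        rw [wronskianAt_snoc, Fin.sum_univ_castSucc] at h1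
        have h2 : (-1 : ℂ) ^ (k + k) = 1 := by rw [← two_mul, pow_mul]; simp
        have h3 := hne0 t ht
        have h4 : ∑ i : Fin k, a i t * iteratedDeriv i y t =
            (∑ i : Fin k, (-1) ^ (k + (i.castSucc : Fin (k + 1)) : ℕ) *
              iteratedDeriv (i.castSucc : Fin (k + 1)) y t * Mi i.castSucc t) /
                wronskianAt f₀ t := by
          rw [Finset.sum_div]
          refine Finset.sum_congr rfl fun i _ => ?_
          simp only [a, Fin.val_castSucc]
          ring
        have h5 : iteratedDeriv k y t = (-1) ^ (k + (Fin.last k) : ℕ) *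
            iteratedDeriv (Fin.last k) y t * Mi (Fin.last k) t / wronskianAt f₀ t := by
          rw [hMlast]
          simp only [Fin.val_last, h2, one_mul]
          field_simp
        rw [h4, h5, ← add_div, add_comm, h1, zero_div]
      have hy0 : jet k y t₁ = 0 := by
        ext j
        have h1 : M.det ≠ 0 := hW
        have h2 : Matrix.vecMul (Matrix.vecMul (jet k g t₁) M⁻¹) M = jet k g t₁ := by
          rw [Matrix.vecMul_vecMul, Matrix.nonsing_inv_mul _ (isUnit_iff_ne_zero.2 h1),
            Matrix.vecMul_one]
        have h3 := congrFun h2 j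
        simp only [jet, Pi.zero_apply]
        rw [hjet j t₁ ht₁, Fin.sum_univ_castSucc]
        simp only [c, Fin.snoc_castSucc, Fin.snoc_last, one_mul, Pi.neg_apply, neg_mul,
          Finset.sum_neg_distrib]
        rw [neg_add_eq_zero]
        exact h3
      refine ⟨J', c, hsub, Metric.isOpen_ball, ⟨t₁, Metric.mem_ball_self hε⟩, fun h => ?_, ?_⟩
      · have := congrFun h (Fin.last k)
        simp [c] at this
      · refine eq_zero_of_jet_eq_zero Metric.isOpen_ball
          (by rw [Real.ball_eq_Ioo]; exact Set.ordConnected_Ioo) (a := a) (fun i => ?_)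
          ((hy.mono hsub).of_le (by exact_mod_cast le_top)) hode (Metric.mem_ball_self hε) hy0
        exact (continuousOn_const.mul ((hMc _).mono hsub)).div
          ((continuousOn_wronskianAt hJ hf₀).mono hsub) hne0

namespace LinDiffOp

variable {I : Set ℝ} {n : ℕ} (L : LinDiffOp I n) (hI : IsOpen I)

theorem wronskian_apply {m : ℕ} (f : Fin m → L.solutionSpace hI) (t : I) :
    wronskian I (fun i => (f i : ℝ → ℂ)) t =
      Matrix.det (Matrix.of fun i => L.jetMap hI m t.2 (f i)) := rfl

theorem continuous_wronskian {m : ℕ} (f : Fin m → L.solutionSpace hI) :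
    Continuous (wronskian I fun i => (f i : ℝ → ℂ)) :=
  continuousOn_iff_continuous_domRestrict.1
    (continuousOn_wronskianAt hI fun i => L.contDiffOn_solution hI (f i).2)

/-- The Wronskian of linearly independent solutions is nonzero on a dense set. -/
theorem dense_wronskian_ne_zero (hc : I.OrdConnected) {m : ℕ} {f : Fin m → L.solutionSpace hI}
    (hf : LinearIndependent ℂ f) :
    Dense {t : I | wronskian I (fun i => (f i : ℝ → ℂ)) t ≠ 0} := by
  intro t
  by_contra h
  rw [mem_closure_iff_nhds] at h
  push Not at h
  obtain ⟨U, hU, hUe⟩ := h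
  obtain ⟨V, hV, hVU⟩ := (mem_nhds_subtype I t U).1 hU
  obtain ⟨ε, hε, hball⟩ := Metric.mem_nhds_iff.1 (Filter.inter_mem hV (hI.mem_nhds t.2))
  obtain ⟨J', c, h1, ho, ⟨s, hs⟩, h3, h4⟩ := exists_linear_relation_of_wronskianAt_eq_zero m
    (Metric.ball (t : ℝ) ε) Metric.isOpen_ball
    (by rw [Real.ball_eq_Ioo]; exact Set.ordConnected_Ioo) ⟨t, Metric.mem_ball_self hε⟩
    (fun i => (f i : ℝ → ℂ))
    (fun i => (L.contDiffOn_solution hI (f i).2).mono fun x hx => (hball hx).2)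
    (fun x hx => by
      by_contra hne
      have : (⟨x, (hball hx).2⟩ : I) ∈ U ∩ {t : I | wronskian I (fun i => (f i : ℝ → ℂ)) t ≠ 0} :=
        ⟨hVU (hball hx).1, hne⟩
      rw [hUe] at this
      exact this)
  have hsI : s ∈ I := (hball (h1 hs)).2
  -- A relation on an open subset kills the full jet at `s`, hence holds on all of `I` by
  -- uniqueness.
  have h0 : ∑ i, c i • f i = 0 := by
    refine L.solution_eq_zero hI hc _ hsI ?_
    ext j
    rw [L.jetMap_apply]
    have : ((∑ i, c i • f i : L.solutionSpace hI) : ℝ → ℂ) =ᶠ[nhds s] fun _ => (0 : ℂ) := by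
      filter_upwards [ho.mem_nhds hs] with x hx
      simpa using h4 x hx
    rw [this.iteratedDeriv_eq, iteratedDeriv_const]
    simp
  exact h3 (funext fun i => Fintype.linearIndependent_iff.1 hf c h0 i)

end LinDiffOp

end Wronskian


/-! ### Lagrange's identity and the symplectic form -/

section Concomitant

variable {I : Set ℝ}

/-- The bilinear expression whose derivative is `g v⁽ᵏ⁾ - (-1)ᵏ g⁽ᵏ⁾ v`. -/
def lagrangeSum (k : ℕ) (g v : ℝ → ℂ) (t : ℝ) : ℂ :=
  ∑ j ∈ Finset.range k, (-1) ^ j * (iteratedDeriv j g t * iteratedDeriv (k - 1 - j) v t)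

theorem hasDerivAt_lagrangeSum (hI : IsOpen I) {g v : ℝ → ℂ} (hg : ContDiffOn ℝ ∞ g I)
    (hv : ContDiffOn ℝ ∞ v I) (k : ℕ) {t : ℝ} (ht : t ∈ I) :
    HasDerivAt (lagrangeSum k g v)
      (g t * iteratedDeriv k v t - (-1) ^ k * iteratedDeriv k g t * v t) t := by
  have hj : ∀ {f : ℝ → ℂ}, ContDiffOn ℝ ∞ f I → ∀ j,
      HasDerivAt (iteratedDeriv j f) (iteratedDeriv (j + 1) f t) t := fun hf j =>
    hf.hasDerivAt_iteratedDeriv hI (by exact_mod_cast le_top) ht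
  have h1 : HasDerivAt (lagrangeSum k g v) (∑ j ∈ Finset.range k, (-1) ^ j *
      (iteratedDeriv (j + 1) g t * iteratedDeriv (k - 1 - j) v t +
        iteratedDeriv j g t * iteratedDeriv (k - 1 - j + 1) v t)) t :=
    HasDerivAt.fun_sum fun j _ => ((hj hg j).mul (hj hv _)).const_mul _
  convert h1 using 1
  -- The alternating signs make the product rule telescope.
  have h2 : ∀ j ∈ Finset.range k, (-1 : ℂ) ^ j *
      (iteratedDeriv (j + 1) g t * iteratedDeriv (k - 1 - j) v t +
        iteratedDeriv j g t * iteratedDeriv (k - 1 - j + 1) v t) =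
      (-1) ^ j * iteratedDeriv j g t * iteratedDeriv (k - j) v t -
        (-1) ^ (j + 1) * iteratedDeriv (j + 1) g t * iteratedDeriv (k - (j + 1)) v t := by
    intro j hjk
    have := Finset.mem_range.1 hjk
    rw [show k - 1 - j + 1 = k - j by omega, show k - (j + 1) = k - 1 - j by omega]
    ring
  rw [Finset.sum_congr rfl h2, Finset.sum_range_sub'
    (fun j => (-1 : ℂ) ^ j * iteratedDeriv j g t * iteratedDeriv (k - j) v t)]
  simp

theorem iteratedDeriv_mul_eq_zero (hI : IsOpen I) {h u : ℝ → ℂ} (hh : ContDiffOn ℝ ∞ h I)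
    (hu : ContDiffOn ℝ ∞ u I) {t : ℝ} (ht : t ∈ I) {p : ℕ}
    (h0 : ∀ j < p, iteratedDeriv j u t = 0) {j : ℕ} (hj : j < p) :
    iteratedDeriv j (fun s => h s * u s) t = 0 := by
  have hs : ∀ {f : ℝ → ℂ}, ContDiffOn ℝ ∞ f I → ContDiffAt ℝ j f t := fun hf =>
    (hf.contDiffAt (hI.mem_nhds ht)).of_le (by exact_mod_cast le_top)
  rw [iteratedDeriv_fun_mul (hs hh) (hs hu)]
  exact Finset.sum_eq_zero fun i _ => by rw [h0 _ (by omega), mul_zero]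

theorem iteratedDeriv_mul_eq (hI : IsOpen I) {h u : ℝ → ℂ} (hh : ContDiffOn ℝ ∞ h I)
    (hu : ContDiffOn ℝ ∞ u I) {t : ℝ} (ht : t ∈ I) {p : ℕ}
    (h0 : ∀ j < p, iteratedDeriv j u t = 0) :
    iteratedDeriv p (fun s => h s * u s) t = h t * iteratedDeriv p u t := by
  have hs : ∀ {f : ℝ → ℂ}, ContDiffOn ℝ ∞ f I → ContDiffAt ℝ p f t := fun hf =>
    (hf.contDiffAt (hI.mem_nhds ht)).of_le (by exact_mod_cast le_top)
  rw [iteratedDeriv_fun_mul (hs hh) (hs hu), Finset.sum_range_succ']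
  rw [Finset.sum_eq_zero fun i hi => by
    rw [h0 _ (by have := Finset.mem_range.1 hi; omega), mul_zero]]
  simp

end Concomitant

namespace LinDiffOp

variable {I : Set ℝ} {n : ℕ} (L : LinDiffOp I n) (hI : IsOpen I)

/-- The bilinear concomitant of `L`. -/
def concomitant (w v : ℝ → ℂ) (t : ℝ) : ℂ :=
  lagrangeSum n w v t + ∑ i : Fin n, lagrangeSum i (fun s => L.coeff i s * w s) v t

include hI in
/-- Lagrange's identity. -/
theorem hasDerivAt_concomitant {w v : ℝ → ℂ} (hw : ContDiffOn ℝ ∞ w I)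
    (hv : ContDiffOn ℝ ∞ v I) {t : ℝ} (ht : t ∈ I) :
    HasDerivAt (L.concomitant w v) (w t * L.apply v t - L.adjointApply w t * v t) t := by
  have h1 := (hasDerivAt_lagrangeSum hI hw hv n ht).add (HasDerivAt.fun_sum fun i (_ : i ∈
    (Finset.univ : Finset (Fin n))) => hasDerivAt_lagrangeSum hI
      ((L.contDiffOn_coeff i).mul hw) hv i ht)
  have e : w t * L.apply v t - L.adjointApply w t * v t =
      (w t * iteratedDeriv n v t - (-1) ^ n * iteratedDeriv n w t * v t) +
      ∑ i : Fin n, (L.coeff i t * w t * iteratedDeriv i v t -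
        (-1) ^ (i : ℕ) * iteratedDeriv i (fun s => L.coeff i s * w s) t * v t) := by
    rw [apply, adjointApply, Finset.sum_sub_distrib, mul_add, add_mul, Finset.mul_sum,
      Finset.sum_mul]
    rw [Finset.sum_congr rfl fun i _ =>
      show w t * (L.coeff i t * iteratedDeriv i v t) = L.coeff i t * w t * iteratedDeriv i v t by
        ring]
    ring
  rw [e]
  exact h1

include hI in
theorem apply_congr {y z : ℝ → ℂ} (h : ∀ t ∈ I, y t = z t) {t : ℝ} (ht : t ∈ I) :
    L.apply y t = L.apply z t := by
  have h1 : y =ᶠ[nhds t] z := by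
    filter_upwards [hI.mem_nhds ht] with s hs using h s hs
  simp only [apply, h1.iteratedDeriv_eq]

include hI in
-- Equivalence gives `μ · L*(μ⁻¹ u) = L u = 0`, so both terms of Lagrange's identity vanish.
theorem concomitant_const (hc : I.OrdConnected) {μ : ℝ → ℂ} (hμ : ContDiffOn ℝ ∞ μ I)
    (hμ0 : ∀ t ∈ I, μ t ≠ 0)
    (hL : ∀ y : ℝ → ℂ, ContDiffOn ℝ ∞ y I →
      ∀ t ∈ I, μ t * L.adjointApply y t = L.apply (fun s => μ s * y s) t)
    {u v : ℝ → ℂ} (hu : u ∈ L.solutionSpace hI) (hv : v ∈ L.solutionSpace hI)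
    {s t : ℝ} (hs : s ∈ I) (ht : t ∈ I) :
    L.concomitant (fun r => (μ r)⁻¹ * u r) v s = L.concomitant (fun r => (μ r)⁻¹ * u r) v t := by
  have hw : ContDiffOn ℝ ∞ (fun r => (μ r)⁻¹ * u r) I :=
    (hμ.inv hμ0).mul (L.contDiffOn_solution hI hu)
  have hd : ∀ r ∈ I, HasDerivAt (L.concomitant (fun r => (μ r)⁻¹ * u r) v) 0 r := by
    intro r hr
    have h1 := L.hasDerivAt_concomitant hI hw (L.contDiffOn_solution hI hv) hr
    have h2 := hL _ hw r hr
    rw [L.apply_congr hI (z := u) (fun x hx => by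
      rw [mul_inv_cancel_left₀ (hμ0 x hx)]) hr, hu.2.1 r hr, mul_eq_zero] at h2
    rw [hv.2.1 r hr, h2.resolve_left (hμ0 r hr)] at h1
    simpa using h1
  exact hI.is_const_of_deriv_eq_zero hc.isPreconnected
    (fun r hr => (hd r hr).differentiableAt.differentiableWithinAt)
    (fun r hr => (hd r hr).deriv) hs ht

include hI in
-- The concomitant pairs derivatives of orders `j` and `i - 1 - j` with `i ≤ n`. Both orders can
-- avoid the zeros of `u` and `v` only if `j ≥ p` and `i - 1 - j ≥ q ≥ n - 1 - p`, which forces `i =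
-- n` and `j = p`.
theorem concomitant_eq {h : ℝ → ℂ} (hh : ContDiffOn ℝ ∞ h I)
    {u v : ℝ → ℂ} (hu : ContDiffOn ℝ ∞ u I) {t : ℝ} (ht : t ∈ I)
    {p q : ℕ} (hu0 : ∀ j < p, iteratedDeriv j u t = 0) (hv0 : ∀ j < q, iteratedDeriv j v t = 0)
    (hp : p < n) (hpq : n ≤ p + q + 1) :
    L.concomitant (fun r => h r * u r) v t =
      (-1) ^ p * (h t * iteratedDeriv p u t * iteratedDeriv (n - 1 - p) v t) := by
  have h1 : ∀ i : Fin n, lagrangeSum i (fun s => L.coeff i s * (h s * u s)) v t = 0 := by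
    intro i
    refine Finset.sum_eq_zero fun j hj => ?_
    have hj := Finset.mem_range.1 hj
    have hi := i.2
    rcases lt_or_ge j p with hjp | hjp
    · simp only [← mul_assoc]
      rw [iteratedDeriv_mul_eq_zero hI ((L.contDiffOn_coeff i).mul hh) hu ht hu0 hjp]
      simp
    · rw [hv0 _ (by omega)]
      simp
  rw [concomitant, Finset.sum_eq_zero fun i _ => h1 i, add_zero, lagrangeSum,
    Finset.sum_eq_single p]
  · rw [iteratedDeriv_mul_eq hI hh hu ht hu0]
  · intro j hj hjp
    have hj := Finset.mem_range.1 hj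
    rcases lt_or_gt_of_ne hjp with hjp | hjp
    · rw [iteratedDeriv_mul_eq_zero hI hh hu ht hu0 hjp]
      simp
    · rw [hv0 _ (by omega)]
      simp
  · intro h
    exact absurd (Finset.mem_range.2 hp) h

/-- The `j`-th derivative of `h y` at `t ∈ I`, as a linear functional of the solution `y`. -/
def derivMul {h : ℝ → ℂ} (hh : ContDiffOn ℝ ∞ h I) (j : ℕ) {t : ℝ} (ht : t ∈ I) :
    L.solutionSpace hI →ₗ[ℂ] ℂ where
  toFun y := iteratedDeriv j (fun s => h s * (y : ℝ → ℂ) s) t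
  map_add' y z := by
    have hs : ∀ y : L.solutionSpace hI, ContDiffAt ℝ j (fun s => h s * (y : ℝ → ℂ) s) t :=
      fun y => ((hh.mul (L.contDiffOn_solution hI y.2)).contDiffAt (hI.mem_nhds ht)).of_le
        (by exact_mod_cast le_top)
    rw [← iteratedDeriv_fun_add (hs y) (hs z)]
    simp [mul_add]
  map_smul' c y := by
    have hs : (fun s => h s * ((c • y : L.solutionSpace hI) : ℝ → ℂ) s) =
        fun s => c * (h s * (y : ℝ → ℂ) s) := by
      ext s
      simp [mul_left_comm]
    rw [hs, iteratedDeriv_const_mul_field]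
    rfl

/-- The bilinear concomitant on the solution space. -/
def concomitantForm {h : ℝ → ℂ} (hh : ContDiffOn ℝ ∞ h I) {t : ℝ} (ht : t ∈ I) :
    L.solutionSpace hI →ₗ[ℂ] L.solutionSpace hI →ₗ[ℂ] ℂ :=
  (∑ j ∈ Finset.range n, (-1 : ℂ) ^ j • (LinearMap.mul ℂ ℂ).compl₁₂ (L.derivMul hI hh j ht)
      (L.derivMul hI contDiffOn_const (h := fun _ => 1) (n - 1 - j) ht)) +
    ∑ i : Fin n, ∑ j ∈ Finset.range i, (-1 : ℂ) ^ j • (LinearMap.mul ℂ ℂ).compl₁₂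
      (L.derivMul hI ((L.contDiffOn_coeff i).mul hh) j ht)
      (L.derivMul hI contDiffOn_const (h := fun _ => 1) ((i : ℕ) - 1 - j) ht)

theorem concomitantForm_apply {h : ℝ → ℂ} (hh : ContDiffOn ℝ ∞ h I) {t : ℝ} (ht : t ∈ I)
    (u v : L.solutionSpace hI) :
    L.concomitantForm hI hh ht u v = L.concomitant (fun s => h s * (u : ℝ → ℂ) s) v t := by
  simp [concomitantForm, concomitant, lagrangeSum, derivMul, mul_assoc]

/-- If `L` is equivalent to its adjoint, then the solution space carries a symplectic form for
which the solutions vanishing to order `m` at any given point form an isotropic subspace. -/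
theorem exists_symplectic_form {m : ℕ} (L : LinDiffOp I (2 * m)) (hc : I.OrdConnected)
    (hne : I.Nonempty) (hL : L.EquivalentToAdjoint) :
    ∃ Ω : L.solutionSpace hI →ₗ[ℂ] L.solutionSpace hI →ₗ[ℂ] ℂ,
      (∀ u v, Ω u v = -Ω v u) ∧ (∀ u, (∀ v, Ω u v = 0) → u = 0) ∧
      ∀ (t : ℝ) (ht : t ∈ I) (u v : L.solutionSpace hI),
        L.jetMap hI m ht u = 0 → L.jetMap hI m ht v = 0 → Ω u v = 0 := by
  classical
  obtain ⟨μ, hμ, hμ0, hL⟩ := hL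
  obtain ⟨t₀, ht₀⟩ := hne
  have hh : ContDiffOn ℝ ∞ (fun s => (μ s)⁻¹) I := hμ.inv hμ0
  have hs : ∀ u : L.solutionSpace hI, ContDiffOn ℝ ∞ (u : ℝ → ℂ) I := fun u =>
    L.contDiffOn_solution hI u.2
  have hΩ : ∀ (t : ℝ) (ht : t ∈ I) (u v : L.solutionSpace hI),
      L.concomitantForm hI hh ht₀ u v = L.concomitant (fun s => (μ s)⁻¹ * (u : ℝ → ℂ) s) v t :=
    fun t ht u v => by
      rw [concomitantForm_apply]
      exact L.concomitant_const hI hc hμ hμ0 hL u.2 v.2 ht₀ ht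
  refine ⟨L.concomitantForm hI hh ht₀ - (L.concomitantForm hI hh ht₀).flip, fun u v => ?_,
    fun u hu => ?_, fun t ht u v hu hv => ?_⟩
  · simp
  · by_contra hne
    have hex : ∃ q, ∃ h : q < 2 * m, L.jetMap hI (2 * m) ht₀ u ⟨q, h⟩ ≠ 0 := by
      by_contra hall
      push Not at hall
      exact hne (L.solution_eq_zero hI hc u ht₀ (funext fun j => hall j j.2))
    obtain ⟨hq, hqne⟩ := Nat.find_spec hex
    have hmin : ∀ j < Nat.find hex, iteratedDeriv j (u : ℝ → ℂ) t₀ = 0 := fun j hj => by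
      have := Nat.find_min hex hj
      push Not at this
      exact this (hj.trans hq)
    set q := Nat.find hex
    -- If `u` vanishes to order exactly `q`, pair it with a solution `v` vanishing to the
    -- complementary order `2m - 1 - q`. One term survives in each of the two concomitants.
    obtain ⟨v, hv⟩ := L.jetMap_surjective hI hc ht₀ (Pi.single ⟨2 * m - 1 - q, by omega⟩ 1)
    have hvj : ∀ j : Fin (2 * m), iteratedDeriv j (v : ℝ → ℂ) t₀ =
        (Pi.single ⟨2 * m - 1 - q, by omega⟩ 1 : Fin (2 * m) → ℂ) j := fun j => by
      rw [← hv, jetMap_apply]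
    have hv0 : ∀ j < 2 * m - 1 - q, iteratedDeriv j (v : ℝ → ℂ) t₀ = 0 := fun j hj => by
      rw [hvj ⟨j, by omega⟩, Pi.single_apply, if_neg]
      simp only [Fin.mk.injEq]
      omega
    have hv1 : iteratedDeriv (2 * m - 1 - q) (v : ℝ → ℂ) t₀ = 1 := by
      rw [hvj ⟨2 * m - 1 - q, by omega⟩]
      simp
    have h1 := L.concomitant_eq hI hh (hs u) ht₀ hmin hv0 hq (by omega)
    have h2 := L.concomitant_eq hI hh (hs v) ht₀ hv0 hmin (by omega) (by omega)
    have h3 := hu v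
    rw [LinearMap.sub_apply, LinearMap.sub_apply, LinearMap.flip_apply, hΩ t₀ ht₀, hΩ t₀ ht₀,
      h1, h2, hv1, show 2 * m - 1 - (2 * m - 1 - q) = q by omega] at h3
    -- The exponents add up to the odd number `2m - 1`, so the two surviving terms add up under
    -- antisymmetrization instead of cancelling. This is where the even order of `L` enters.
    have h4 : (-1 : ℂ) ^ (2 * m - 1 - q) = -(-1) ^ q := by
      have h5 : (-1 : ℂ) ^ (2 * m - 1 - q) * (-1) ^ q = -1 := by
        rw [← pow_add]
        exact Odd.neg_one_pow ⟨m - 1, by omega⟩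
      have h6 : (-1 : ℂ) ^ q * (-1) ^ q = 1 := by rw [← pow_add, ← two_mul, pow_mul]; simp
      linear_combination (-1 : ℂ) ^ q * h5 - (-1 : ℂ) ^ (2 * m - 1 - q) * h6
    rw [h4] at h3
    have h7 : (-1 : ℂ) ^ q ≠ 0 := pow_ne_zero _ (by norm_num)
    have h8 : (2 : ℂ) * ((-1) ^ q * ((μ t₀)⁻¹ * iteratedDeriv q (u : ℝ → ℂ) t₀)) = 0 := by
      linear_combination h3
    simp only [mul_eq_zero, OfNat.ofNat_ne_zero, h7, inv_eq_zero, hμ0 t₀ ht₀, false_or] at h8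
    exact hqne h8
  · have hu0 : ∀ j < m, iteratedDeriv j (u : ℝ → ℂ) t = 0 := fun j hj => congrFun hu ⟨j, hj⟩
    have hv0 : ∀ j < m, iteratedDeriv j (v : ℝ → ℂ) t = 0 := fun j hj => congrFun hv ⟨j, hj⟩
    rcases Nat.eq_zero_or_pos m with rfl | hm
    · have : u = 0 := L.solution_eq_zero hI hc u ht (funext fun j => absurd j.2 (by omega))
      simp [this]
    · rw [LinearMap.sub_apply, LinearMap.sub_apply, LinearMap.flip_apply, hΩ t ht, hΩ t ht,
        L.concomitant_eq hI hh (hs u) ht hu0 hv0 (by omega) (by omega),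
        L.concomitant_eq hI hh (hs v) ht hv0 hu0 (by omega) (by omega),
        hv0 _ (by omega), hu0 (2 * m - 1 - m) (by omega)]
      simp

end LinDiffOp


/-! ### Symplectic linear algebra and symmetric matrices -/

section SymplecticBasis

variable {V : Type*} [AddCommGroup V] [Module ℂ V]

/-- A Lagrangian subspace of a symplectic space is spanned by the second half of some symplectic
basis. -/
theorem exists_symplectic_basis [FiniteDimensional ℂ V] {m : ℕ} (hm : 1 ≤ m) (Ω : V →ₗ[ℂ] V →ₗ[ℂ] ℂ)
    (hskew : ∀ u v, Ω u v = -Ω v u) (hnd : ∀ u, (∀ v, Ω u v = 0) → u = 0) (E : Submodule ℂ V)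
    (hE : Module.finrank ℂ E = m) (hV : Module.finrank ℂ V = 2 * m)
    (hiso : ∀ u ∈ E, ∀ v ∈ E, Ω u v = 0) :
    ∃ b : Module.Basis (Fin m ⊕ Fin m) ℂ V, (∀ i, b (Sum.inr i) ∈ E) ∧
      (∀ i j, Ω (b (Sum.inl i)) (b (Sum.inl j)) = 0) ∧
      (∀ i j, Ω (b (Sum.inl i)) (b (Sum.inr j)) = if i = j then 1 else 0) ∧
      ∀ i j, Ω (b (Sum.inr i)) (b (Sum.inr j)) = 0 := by
  let e := Module.finBasisOfFinrankEq ℂ E hE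
  have hsurj : Function.Surjective Ω := by
    refine (LinearMap.injective_iff_surjective_of_finrank_eq_finrank
      (Subspace.dual_finrank_eq (K := ℂ) (V := V)).symm).1 ?_
    rw [injective_iff_map_eq_zero]
    exact fun u hu => hnd u fun v => by rw [hu, LinearMap.zero_apply]
  have hx : ∀ a, ∃ x : V, ∀ c, Ω x (e c) = if a = c then 1 else 0 := by
    intro a
    obtain ⟨f, hf⟩ := LinearMap.exists_extend (e.coord a)
    obtain ⟨x, hx⟩ := hsurj f
    refine ⟨x, fun c => ?_⟩
    have : f (e c) = e.coord a (e c) := by rw [← hf]; rfl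
    rw [hx, this, Module.Basis.coord_apply, Module.Basis.repr_self, Finsupp.single_apply]
    simp [eq_comm]
  choose x hx using hx
  have hx' : ∀ a c, Ω (e c) (x a) = -(if a = c then 1 else 0) := fun a c => by
    rw [hskew, hx]
  have hee : ∀ a c, Ω (e a) (e c) = 0 := fun a c => hiso _ (e a).2 _ (e c).2
  -- The dual vectors `x a` need not be isotropic; half of `Ω (x a) (x c)`, shifted along the
  -- Lagrangian, corrects this without changing the pairing with `e`.
  let y : Fin m → V := fun a => x a + ∑ c, (Ω (x a) (x c) / 2) • (e c : V)
  have hye : ∀ a c, Ω (y a) (e c) = if a = c then 1 else 0 := fun a c => by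
    simp [y, hx, hee]
  have hyy : ∀ a c, Ω (y a) (y c) = 0 := fun a c => by
    simp only [y, map_add, map_sum, map_smul, LinearMap.add_apply, LinearMap.sum_apply,
      LinearMap.smul_apply, hx, hx', hee, smul_eq_mul, mul_ite, mul_one, mul_zero,
      Finset.sum_ite_eq, Finset.mem_univ, if_true, mul_neg, Finset.sum_neg_distrib,
      Finset.sum_const_zero, add_zero]
    rw [hskew (x c) (x a)]
    ring
  let v : Fin m ⊕ Fin m → V := Sum.elim y fun c => (e c : V)
  have hli : LinearIndependent ℂ v := by
    rw [Fintype.linearIndependent_iff]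
    intro g hg
    rw [Fintype.sum_sum_type] at hg
    have hl : ∀ c, g (Sum.inl c) = 0 := fun c => by
      have := congrArg (fun z => Ω z (e c)) hg
      simpa [v, hye, hee] using this
    intro i
    rcases i with c | c
    · exact hl c
    · have := congrArg (fun z => Ω (y c) z) hg
      simpa [v, hye, hyy] using this
  have : Nonempty (Fin m) := ⟨⟨0, hm⟩⟩
  refine ⟨basisOfLinearIndependentOfCardEqFinrank hli (by simp [hV, two_mul]), ?_, ?_, ?_, ?_⟩ <;>
    simp [v, hye, hyy, hee]

end SymplecticBasis

section SymmetricMatrix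

variable {m : ℕ}

/-- An alternating form applied to a symmetric tensor in two of its arguments vanishes. -/
theorem sum_det_update_eq_zero {A B S : Matrix (Fin m) (Fin m) ℂ} (hS : S.transpose = S)
    (hB : B = S * A) (R : Fin m → Fin m → ℂ) {i j : Fin m} (hij : i ≠ j) :
    ∑ a, Matrix.det (Matrix.of
      (Function.update (Function.update R i (A a)) j (B a))) = 0 := by
  let D : Fin m → Fin m → ℂ := fun a c =>
    Matrix.detRowAlternating (Function.update (Function.update R i (A a)) j (A c))
  have hD : ∀ a c, D a c = -D c a := by
    intro a c
    have h := (Matrix.detRowAlternating (R := ℂ) (n := Fin m)).map_swap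
      (Function.update (Function.update R i (A c)) j (A a)) hij
    simp only [D]
    rw [← h]
    congr 1
    ext k : 1
    simp only [Function.comp_apply]
    rcases eq_or_ne k i with rfl | hki
    · rw [Equiv.swap_apply_left, Function.update_self, Function.update_of_ne hij,
        Function.update_self]
    · rcases eq_or_ne k j with rfl | hkj
      · rw [Equiv.swap_apply_right, Function.update_self, Function.update_of_ne hij,
          Function.update_self]
      · rw [Equiv.swap_apply_of_ne_of_ne hki hkj]
        simp [Function.update_of_ne hki, Function.update_of_ne hkj]
  -- Substituting `B = S A` contracts the symmetric `S` with the antisymmetric `D`.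
  have h1 : ∀ a, Matrix.det (Matrix.of (Function.update (Function.update R i (A a)) j (B a))) =
      ∑ c, S a c * D a c := by
    intro a
    have hBa : B a = ∑ c, S a c • A c := by
      ext l
      simp [hB, Matrix.mul_apply]
    have h2 := (Matrix.detRowAlternating (R := ℂ) (n := Fin m)).toMultilinearMap.map_update_sum
      (Finset.univ) j (fun c => S a c • A c) (Function.update R i (A a))
    rw [hBa]
    refine h2.trans (Finset.sum_congr rfl fun c _ => ?_)
    exact (Matrix.detRowAlternating (R := ℂ) (n := Fin m)).toMultilinearMap.map_update_smul _ _ _ _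
  have hS' : ∀ a c, S a c = S c a := fun a c => congrFun (congrFun hS.symm a) c
  have h2 : ∑ a, ∑ c, S a c * D a c = -∑ a, ∑ c, S a c * D a c := by
    conv_lhs => rw [Finset.sum_comm]
    rw [← Finset.sum_neg_distrib]
    refine Finset.sum_congr rfl fun a _ => ?_
    rw [← Finset.sum_neg_distrib]
    exact Finset.sum_congr rfl fun c _ => by rw [hD, hS' a c]; ring
  rw [Finset.sum_congr rfl fun a _ => h1 a]
  linear_combination (1 / 2 : ℂ) * h2

/-- Both sides factor through `det A`, and `det (1 + Z S) = det (1 + S Zᵀ) = det (1 + Zᵀ S)` by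
transposition and Sylvester's identity. This is the involution behind the even degree. -/
theorem det_add_mul_eq_det_add_transpose_mul {A B S : Matrix (Fin m) (Fin m) ℂ}
    (hS : S.transpose = S) (hB : B = S * A) (Z : Matrix (Fin m) (Fin m) ℂ) :
    (A + Z * B).det = (A + Z.transpose * B).det := by
  have h : ∀ Y : Matrix (Fin m) (Fin m) ℂ, (A + Y * B).det = (1 + Y * S).det * A.det := by
    intro Y
    rw [← Matrix.det_mul, add_mul, one_mul, hB, mul_assoc]
  rw [h, h, ← Matrix.det_transpose (1 + Z * S), Matrix.transpose_add, Matrix.transpose_mul, hS,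
    Matrix.transpose_one, Matrix.det_one_add_mul_comm]

end SymmetricMatrix

/-! ### Bases adapted to the symplectic form -/

namespace LinDiffOp

variable {I : Set ℝ} {n m : ℕ} (L : LinDiffOp I n) (hI : IsOpen I)

/-- The matrix of the `m`-jets at `t` of `m` solutions. -/
def jetMatrix (f : Fin m → L.solutionSpace hI) (t : I) : Matrix (Fin m) (Fin m) ℂ :=
  Matrix.of fun i => L.jetMap hI m t.2 (f i)

theorem det_jetMatrix (f : Fin m → L.solutionSpace hI) (t : I) :
    (L.jetMatrix hI f t).det = wronskian I (fun i => (f i : ℝ → ℂ)) t := rfl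

theorem jetMatrix_linearCombination (b : Fin m ⊕ Fin m → L.solutionSpace hI)
    (X Y : Matrix (Fin m) (Fin m) ℂ) (t : I) :
    L.jetMatrix hI (fun i => ∑ j, X i j • b (Sum.inl j) + ∑ j, Y i j • b (Sum.inr j)) t =
      X * L.jetMatrix hI (b ∘ Sum.inl) t + Y * L.jetMatrix hI (b ∘ Sum.inr) t := by
  ext i j
  simp [jetMatrix, Matrix.mul_apply]

/-- The properties of a basis of the solution space adapted to the symplectic structure: at a
general point `t`, the matrix of jets is `(1, S) * A` with `S` symmetric. -/
structure IsAdapted (b : Module.Basis (Fin m ⊕ Fin m) ℂ (L.solutionSpace hI)) (t₀ : I) : Prop where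
  jet_inr : ∀ i, L.jetMap hI m t₀.2 (b (Sum.inr i)) = 0
  det_ne_zero : (L.jetMatrix hI (b ∘ Sum.inl) t₀).det ≠ 0
  exists_symm : ∀ t, (L.jetMatrix hI (b ∘ Sum.inl) t).det ≠ 0 →
    ∃ S : Matrix (Fin m) (Fin m) ℂ, S.transpose = S ∧
      L.jetMatrix hI (b ∘ Sum.inr) t = S * L.jetMatrix hI (b ∘ Sum.inl) t

/-- The vectors `b (inr i)` span the Lagrangian of solutions vanishing to order `m` at `t₀`, and the
`b (inl i)` span a complementary Lagrangian dual to it. -/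
theorem exists_isAdapted (hm : 1 ≤ m) (L : LinDiffOp I (2 * m)) (hc : I.OrdConnected) (t₀ : I)
    (hL : L.EquivalentToAdjoint) :
    ∃ b : Module.Basis (Fin m ⊕ Fin m) ℂ (L.solutionSpace hI), L.IsAdapted hI b t₀ := by
  have hne : I.Nonempty := ⟨t₀, t₀.2⟩
  have := L.finiteDimensional_solutionSpace hI hc hne
  obtain ⟨Ω, hskew, hnd, hiso⟩ := exists_symplectic_form hI L hc hne hL
  have hV := L.finrank_solutionSpace hI hc hne
  have hsurj : Function.Surjective (L.jetMap hI m t₀.2) := by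
    intro x
    obtain ⟨y, hy⟩ := L.jetMap_surjective hI hc t₀.2 fun j => if h : (j : ℕ) < m then x ⟨j, h⟩ else 0
    refine ⟨y, ?_⟩
    ext j
    have := congrFun hy ⟨j, by omega⟩
    simpa [jetMap_apply] using this
  have hE : Module.finrank ℂ (LinearMap.ker (L.jetMap hI m t₀.2)) = m := by
    have h1 := LinearMap.finrank_range_add_finrank_ker (L.jetMap hI m t₀.2)
    rw [LinearMap.range_eq_top.2 hsurj, finrank_top, Module.finrank_fin_fun, hV] at h1
    omega
  obtain ⟨b, hb1, hb2, hb3, hb4⟩ := exists_symplectic_basis hm Ω hskew hnd _ hE hV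
    fun u hu v hv => hiso t₀ t₀.2 u v (LinearMap.mem_ker.1 hu) (LinearMap.mem_ker.1 hv)
  have hb3' : ∀ i j, Ω (b (Sum.inr j)) (b (Sum.inl i)) = -(if i = j then 1 else 0) := fun i j => by
    rw [hskew, hb3]
  refine ⟨b, hb1, fun h => ?_, fun t ht => ?_⟩
  -- A kernel vector `c` gives a combination of the `inl` vectors vanishing to order `m` at `t₀`. It
  -- pairs to zero with the `inr` vectors, yet those pairings are the entries of `c`.
  · obtain ⟨c, hc0, hcA⟩ := Matrix.exists_vecMul_eq_zero_iff.2 h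
    refine hc0 (funext fun j => ?_)
    have h1 : L.jetMap hI m t₀.2 (∑ i, c i • b (Sum.inl i)) = 0 := by
      ext l
      have := congrFun hcA l
      simpa [jetMatrix, Matrix.vecMul, dotProduct] using this
    have h2 := hiso t₀ t₀.2 _ _ h1 (hb1 j)
    simpa [hb3] using h2
  · set A := L.jetMatrix hI (b ∘ Sum.inl) t with hA
    set B := L.jetMatrix hI (b ∘ Sum.inr) t with hB
    have hSA : B = B * A⁻¹ * A := by
      rw [mul_assoc, Matrix.nonsing_inv_mul _ (isUnit_iff_ne_zero.2 ht), mul_one]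
    refine ⟨B * A⁻¹, ?_, hSA⟩
    set S := B * A⁻¹
    -- These combinations vanish to order `m` at `t`, hence are pairwise orthogonal; expanding `Ω`
    -- of two of them in the symplectic basis gives `S a c = S c a`.
    have hu : ∀ a, L.jetMap hI m t.2 (b (Sum.inr a) - ∑ c, S a c • b (Sum.inl c)) = 0 := by
      intro a
      ext l
      have := congrFun (congrFun hSA a) l
      rw [Matrix.mul_apply] at this
      simp only [map_sub, map_sum, map_smul, Pi.sub_apply, Finset.sum_apply, Pi.smul_apply,
        smul_eq_mul, Pi.zero_apply, sub_eq_zero]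
      exact this
    ext a c
    have h := hiso t t.2 _ _ (hu a) (hu c)
    simp only [map_sub, map_sum, map_smul, LinearMap.sub_apply, LinearMap.sum_apply,
      LinearMap.smul_apply, hb2, hb3, hb3', hb4, smul_eq_mul, mul_zero, Finset.sum_const_zero,
      mul_ite, mul_one, mul_neg, Finset.sum_neg_distrib, Finset.sum_ite_eq', Finset.mem_univ,
      if_true, zero_sub, sub_zero] at h
    rw [Matrix.transpose_apply]
    linear_combination h

end LinDiffOp


theorem Submodule.exists_linearIndependent_span_eq {V : Type*} [AddCommGroup V] [Module ℂ V]
    [FiniteDimensional ℂ V] {m : ℕ} (H : Submodule ℂ V) (hH : Module.finrank ℂ H = m) :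
    ∃ f : Fin m → V, LinearIndependent ℂ f ∧ Submodule.span ℂ (Set.range f) = H := by
  let e := Module.finBasisOfFinrankEq ℂ H hH
  refine ⟨fun i => (e i : V),
    e.linearIndependent.map' H.subtype (Submodule.ker_subtype _), ?_⟩
  have h : Set.range (fun i => (e i : V)) = H.subtype '' Set.range e := by
    rw [← Set.range_comp]
    rfl
  rw [h, Submodule.span_image, e.span_eq, Submodule.map_top, Submodule.range_subtype]

/-! ### The Wronskian as an alternating map; the Wronski map -/

namespace LinDiffOp

variable {I : Set ℝ} {n m : ℕ} (L : LinDiffOp I n) (hI : IsOpen I)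

/-- The Wronskian as an alternating map on the solution space. -/
def wronskianMap (m : ℕ) : L.solutionSpace hI [⋀^Fin m]→ₗ[ℂ] (I → ℂ) where
  toFun f := wronskian I fun i => (f i : ℝ → ℂ)
  map_update_add' := fun {inst} f i x y => by
    obtain rfl := Subsingleton.elim inst (instDecidableEqFin m)
    ext t
    exact ((Matrix.detRowAlternating (R := ℂ) (n := Fin m)).compLinearMap
      (L.jetMap hI m t.2)).map_update_add f i x y
  map_update_smul' := fun {inst} f i c x => by
    obtain rfl := Subsingleton.elim inst (instDecidableEqFin m)
    ext t
    exact ((Matrix.detRowAlternating (R := ℂ) (n := Fin m)).compLinearMap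
      (L.jetMap hI m t.2)).map_update_smul f i c x
  map_eq_zero_of_eq' f i j h hij := by
    ext t
    exact ((Matrix.detRowAlternating (R := ℂ) (n := Fin m)).compLinearMap
      (L.jetMap hI m t.2)).map_eq_zero_of_eq f h hij

theorem wronskianMap_apply (f : Fin m → L.solutionSpace hI) :
    L.wronskianMap hI m f = wronskian I fun i => (f i : ℝ → ℂ) := rfl

theorem wronskian_ne_zero (hc : I.OrdConnected) (hne : I.Nonempty)
    {f : Fin m → L.solutionSpace hI} (hf : LinearIndependent ℂ f) :
    wronskian I (fun i => (f i : ℝ → ℂ)) ≠ 0 := by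
  have : Nonempty I := hne.to_subtype
  obtain ⟨t, ht⟩ := (L.dense_wronskian_ne_zero hI hc hf).nonempty
  exact fun h => ht (congrFun h t)

/-- The Wronskians of families in the span of `f` are multiples of the Wronskian of `f`. -/
theorem wronskian_mem_span {f g : Fin m → L.solutionSpace hI}
    (h : ∀ i, g i ∈ Submodule.span ℂ (Set.range f)) :
    wronskian I (fun i => (g i : ℝ → ℂ)) ∈
      Submodule.span ℂ {wronskian I fun i => (f i : ℝ → ℂ)} := by
  have h' : ∀ i, ∃ c : Fin m → ℂ, ∑ j, c j • f j = g i := fun i =>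
    (Submodule.mem_span_range_iff_exists_fun ℂ).1 (h i)
  choose c hc using h'
  refine Submodule.mem_span_singleton.2 ⟨(Matrix.of c).det, ?_⟩
  ext t
  rw [Pi.smul_apply, smul_eq_mul, wronskian_apply, wronskian_apply, ← Matrix.det_mul]
  congr 1
  ext i j
  rw [Matrix.mul_apply, Matrix.of_apply, ← hc i]
  simp

theorem wronskiMap_eq_span (H : Grassmannian m (L.solutionSpace hI))
    {f : Fin m → L.solutionSpace hI} (hf : Submodule.span ℂ (Set.range f) = H.1) :
    wronskiMap I m (L.solutionSpace hI) H =
      Submodule.span ℂ {wronskian I fun i => (f i : ℝ → ℂ)} := by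
  refine le_antisymm (Submodule.span_le.2 ?_) (Submodule.span_mono ?_)
  · rintro w ⟨g, hg, rfl⟩
    refine L.wronskian_mem_span hI fun i => ?_
    rw [hf, ← hg]
    exact Submodule.subset_span ⟨i, rfl⟩
  · rintro w rfl
    exact ⟨f, hf, rfl⟩

theorem finrank_wronskiMap (hc : I.OrdConnected) (hne : I.Nonempty)
    (H : Grassmannian m (L.solutionSpace hI)) :
    Module.finrank ℂ (wronskiMap I m (L.solutionSpace hI) H) = 1 := by
  have := L.finiteDimensional_solutionSpace hI hc hne
  obtain ⟨f, hf, hfH⟩ := Submodule.exists_linearIndependent_span_eq H.1 H.2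
  rw [L.wronskiMap_eq_span hI H hfH]
  exact finrank_span_singleton (L.wronskian_ne_zero hI hc hne hf)

/-! ### Linear relations and the dimension bound -/

section Relations

variable {b : Module.Basis (Fin m ⊕ Fin m) ℂ (L.solutionSpace hI)} {t₀ : I}

theorem dense_det_ne_zero (hc : I.OrdConnected)
    (b : Module.Basis (Fin m ⊕ Fin m) ℂ (L.solutionSpace hI)) :
    Dense {t : I | (L.jetMatrix hI (b ∘ Sum.inl) t).det ≠ 0} :=
  L.dense_wronskian_ne_zero hI hc (b.linearIndependent.comp _ Sum.inl_injective)

/-- Where `det A ≠ 0` this is the symmetry of `S`; density and continuity extend it to all of `I`.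
-/
theorem sum_wronskianMap_update_eq_zero (hc : I.OrdConnected) (hb : L.IsAdapted hI b t₀)
    (f : Fin m → L.solutionSpace hI) {i j : Fin m} (hij : i ≠ j) :
    ∑ a, L.wronskianMap hI m
      (Function.update (Function.update f i (b (Sum.inl a))) j (b (Sum.inr a))) = 0 := by
  have hcont : Continuous (∑ a, L.wronskianMap hI m
      (Function.update (Function.update f i (b (Sum.inl a))) j (b (Sum.inr a)))) := by
    rw [show (∑ a, L.wronskianMap hI m
      (Function.update (Function.update f i (b (Sum.inl a))) j (b (Sum.inr a)))) = fun t =>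
        ∑ a, L.wronskianMap hI m
      (Function.update (Function.update f i (b (Sum.inl a))) j (b (Sum.inr a))) t from
      funext fun t => Finset.sum_apply _ _ _]
    exact continuous_finsetSum _ fun a _ => L.continuous_wronskian hI _
  refine Continuous.ext_on (L.dense_det_ne_zero hI hc b) hcont continuous_const fun t ht => ?_
  obtain ⟨S, hS, hB⟩ := hb.exists_symm t ht
  rw [Finset.sum_apply]
  change _ = (0 : ℂ)
  rw [← sum_det_update_eq_zero hS hB (fun i => L.jetMap hI m t.2 (f i)) hij]
  refine Finset.sum_congr rfl fun a _ => ?_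
  rw [wronskianMap_apply, wronskian_apply]
  congr 2
  ext k : 1
  simp only [Function.update_apply]
  split_ifs <;> rfl

/-- For an adapted basis, the Wronskians are spanned by those of the subsets of the basis that do
not contain two given dual vectors. -/
theorem wronskianSpan_le_span (hc : I.OrdConnected) (hb : L.IsAdapted hI b t₀) (p : Fin m)
    (enum : Finset (Fin m ⊕ Fin m) → Fin m → Fin m ⊕ Fin m)
    (henum : ∀ S : Finset (Fin m ⊕ Fin m), S.card = m → Set.BijOn (enum S) Set.univ S) :
    wronskianSpan I m (L.solutionSpace hI) ≤ Submodule.span ℂ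
      ((fun S => L.wronskianMap hI m (b ∘ enum S)) ''
        ((Finset.univ : Finset (Fin m ⊕ Fin m)).powersetCard m |>.filter
          fun S => ¬ (Sum.inl p ∈ S ∧ Sum.inr p ∈ S) : Finset (Finset (Fin m ⊕ Fin m)))) := by
  classical
  set U := Submodule.span ℂ
      ((fun S => L.wronskianMap hI m (b ∘ enum S)) ''
        ((Finset.univ : Finset (Fin m ⊕ Fin m)).powersetCard m |>.filter
          fun S => ¬ (Sum.inl p ∈ S ∧ Sum.inr p ∈ S) : Finset (Finset (Fin m ⊕ Fin m)))) with hU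
  have h1 : ∀ s : Fin m → Fin m ⊕ Fin m,
      ¬ (Sum.inl p ∈ Set.range s ∧ Sum.inr p ∈ Set.range s) →
      L.wronskianMap hI m (b ∘ s) ∈ U := by
    intro s hs
    by_cases hinj : Function.Injective s
    · let S : Finset (Fin m ⊕ Fin m) := Finset.univ.image s
      have hScard : S.card = m := by
        rw [Finset.card_image_of_injective _ hinj, Finset.card_univ, Fintype.card_fin]
      have hmem : ∀ x, x ∈ S ↔ x ∈ Set.range s := fun x => by simp [S]
      have hbij := henum S hScard
      have hσ : ∀ i, ∃ k, enum S k = s i := fun i => by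
        obtain ⟨k, _, hk⟩ := hbij.surjOn ((hmem _).2 ⟨i, rfl⟩)
        exact ⟨k, hk⟩
      choose σ hσ using hσ
      have hσinj : Function.Injective σ := fun i j hij => hinj (by rw [← hσ, ← hσ, hij])
      let τ : Equiv.Perm (Fin m) := Equiv.ofBijective σ (Finite.injective_iff_bijective.1 hσinj)
      have hs' : b ∘ s = (b ∘ enum S) ∘ τ := by
        ext i : 1
        simp [τ, hσ]
      rw [hs', AlternatingMap.map_perm]
      have hSU : L.wronskianMap hI m (b ∘ enum S) ∈ U := by
        refine Submodule.subset_span ⟨S, ?_, rfl⟩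
        simp only [Finset.coe_filter, Finset.mem_powersetCard_univ, Set.mem_ofPred_eq]
        exact ⟨hScard, by rwa [hmem, hmem]⟩
      rcases Int.units_eq_one_or (Equiv.Perm.sign τ) with h | h <;> rw [h]
      · simpa using hSU
      · simpa using hSU
    · rw [Function.not_injective_iff] at hinj
      obtain ⟨i, j, hij, hne⟩ := hinj
      rw [AlternatingMap.map_eq_zero_of_eq _ (i := i) (j := j) _ (by simp [hij]) hne]
      exact U.zero_mem
  have h2 : ∀ s : Fin m → Fin m ⊕ Fin m, L.wronskianMap hI m (b ∘ s) ∈ U := by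
    intro s
    by_cases hs : Sum.inl p ∈ Set.range s ∧ Sum.inr p ∈ Set.range s
    swap
    · exact h1 s hs
    by_cases hinj : Function.Injective s
    · obtain ⟨⟨i, hi⟩, ⟨j, hj⟩⟩ := hs
      have hij : i ≠ j := by
        rintro rfl
        rw [hi] at hj
        exact Sum.inl_ne_inr hj
      have hrel := L.sum_wronskianMap_update_eq_zero hI hc hb (b ∘ s) hij
      have hupd : ∀ a, Function.update (Function.update (b ∘ s) i (b (Sum.inl a))) j
          (b (Sum.inr a)) = b ∘ Function.update (Function.update s i (Sum.inl a)) j (Sum.inr a) :=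
        fun a => by rw [Function.comp_update, Function.comp_update]
      simp only [hupd] at hrel
      rw [← Finset.add_sum_erase _ _ (Finset.mem_univ p)] at hrel
      have hsp : Function.update (Function.update s i (Sum.inl p)) j (Sum.inr p) = s := by
        rw [← hi, Function.update_eq_self, ← hj, Function.update_eq_self]
      rw [hsp, add_eq_zero_iff_eq_neg] at hrel
      rw [hrel]
      -- In every other term the entry `inl p` has been replaced by `inl a` and, `s` being
      -- injective, occurs nowhere else. Terms with repeated entries vanish and are covered by `h1`.
      refine U.neg_mem (U.sum_mem fun a ha => h1 _ ?_)
      have hap : a ≠ p := Finset.ne_of_mem_erase ha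
      rintro ⟨⟨k, hk⟩, -⟩
      rcases eq_or_ne k j with rfl | hkj
      · simp at hk
      · rw [Function.update_of_ne hkj] at hk
        rcases eq_or_ne k i with rfl | hki
        · simp [hap] at hk
        · rw [Function.update_of_ne hki, ← hi] at hk
          exact hki (hinj hk)
    · rw [Function.not_injective_iff] at hinj
      obtain ⟨i, j, hij, hne⟩ := hinj
      rw [AlternatingMap.map_eq_zero_of_eq _ (i := i) (j := j) _ (by simp [hij]) hne]
      exact U.zero_mem
  refine Submodule.span_le.2 ?_
  rintro _ ⟨f, rfl⟩
  change L.wronskianMap hI m f ∈ U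
  have hf : f = fun i => ∑ k, b.repr (f i) k • b k := funext fun i => (b.sum_repr (f i)).symm
  rw [hf]
  have := (L.wronskianMap hI m).toMultilinearMap.map_sum (fun i k => b.repr (f i) k • b k)
  refine this.symm ▸ U.sum_mem fun r _ => ?_
  have h3 := (L.wronskianMap hI m).toMultilinearMap.map_smul_univ
    (fun i => b.repr (f i) (r i)) (fun i => b (r i))
  exact h3.symm ▸ U.smul_mem _ (h2 r)

/-- Adjoining both vectors of the pair to an `(m - 2)`-subset of the rest is injective, so at least
`(2m-2).choose (m-2)` subsets are excluded. -/
theorem card_filter_not_pair_le (p : Fin m) :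
    ((Finset.univ : Finset (Fin m ⊕ Fin m)).powersetCard m |>.filter
      fun S => ¬ (Sum.inl p ∈ S ∧ Sum.inr p ∈ S)).card ≤
      (2 * m).choose m - (if 2 ≤ m then (2 * m - 2).choose (m - 2) else 0) := by
  classical
  have h1 := Finset.card_filter_add_card_filter_not (s := (Finset.univ :
    Finset (Fin m ⊕ Fin m)).powersetCard m) (fun S => Sum.inl p ∈ S ∧ Sum.inr p ∈ S)
  rw [Finset.card_powersetCard, Finset.card_univ, Fintype.card_sum, Fintype.card_fin,
    ← two_mul] at h1
  split_ifs with h2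
  · have h3 : (2 * m - 2).choose (m - 2) ≤ ((Finset.univ :
        Finset (Fin m ⊕ Fin m)).powersetCard m |>.filter
          fun S => Sum.inl p ∈ S ∧ Sum.inr p ∈ S).card := by
      let R : Finset (Fin m ⊕ Fin m) := Finset.univ \ {Sum.inl p, Sum.inr p}
      have hpair : ({Sum.inl p, Sum.inr p} : Finset (Fin m ⊕ Fin m)).card = 2 :=
        Finset.card_pair Sum.inl_ne_inr
      have hR : R.card = 2 * m - 2 := by
        rw [Finset.card_sdiff_of_subset (Finset.subset_univ _), hpair, Finset.card_univ,
          Fintype.card_sum, Fintype.card_fin, two_mul]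
      rw [← hR, ← Finset.card_powersetCard]
      have hdisj : ∀ T ∈ R.powersetCard (m - 2),
          Disjoint T ({Sum.inl p, Sum.inr p} : Finset (Fin m ⊕ Fin m)) := fun T hT =>
        Finset.disjoint_of_subset_left (Finset.mem_powersetCard.1 hT).1 Finset.sdiff_disjoint
      refine Finset.card_le_card_of_injOn (fun T => T ∪ {Sum.inl p, Sum.inr p}) (fun T hT => ?_)
        fun T hT T' hT' h => ?_
      · have hd := hdisj T hT
        have hT := (Finset.mem_powersetCard.1 hT).2
        simp only [Finset.coe_filter, Finset.mem_powersetCard_univ, Set.mem_ofPred_eq]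
        refine ⟨?_, by simp, by simp⟩
        rw [Finset.card_union_of_disjoint hd, hT, hpair]
        omega
      · rw [← Finset.union_sdiff_cancel_right (hdisj T hT),
          ← Finset.union_sdiff_cancel_right (hdisj T' hT')]
        exact congrArg (· \ ({Sum.inl p, Sum.inr p} : Finset (Fin m ⊕ Fin m))) h
    omega
  · omega

theorem rank_wronskianSpan_le (hm : 1 ≤ m) (hc : I.OrdConnected) (hb : L.IsAdapted hI b t₀) :
    Module.rank ℂ (wronskianSpan I m (L.solutionSpace hI)) ≤
      (((2 * m).choose m - (if 2 ≤ m then (2 * m - 2).choose (m - 2) else 0) : ℕ) : Cardinal) := by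
  classical
  let enum : Finset (Fin m ⊕ Fin m) → Fin m → Fin m ⊕ Fin m := fun S =>
    if h : S.card = m then fun i => ((S.equivFinOfCardEq h).symm i : Fin m ⊕ Fin m)
    else fun i => Sum.inl i
  have henum : ∀ S : Finset (Fin m ⊕ Fin m), S.card = m → Set.BijOn (enum S) Set.univ S := by
    intro S h
    simp only [enum, h, dite_true]
    refine ⟨fun i _ => ((S.equivFinOfCardEq h).symm i).2,
      fun i _ j _ hij => (S.equivFinOfCardEq h).symm.injective (Subtype.ext hij), fun x hx => ?_⟩
    exact ⟨S.equivFinOfCardEq h ⟨x, hx⟩, trivial, by simp⟩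
  have h1 := L.wronskianSpan_le_span hI hc hb ⟨0, hm⟩ enum henum
  refine (Submodule.rank_mono h1).trans ?_
  rw [← Finset.coe_image]
  refine (rank_span_finset_le _).trans ?_
  exact_mod_cast Finset.card_image_le.trans (card_filter_not_pair_le _)

end Relations

end LinDiffOp


/-! ### Generic cardinality of fibres of a finite extension -/

section GenericFibre

open Polynomial

variable {A B k : Type*} [CommRing A] [CommRing B] [Algebra A B] [Field k]

/-- If `θ` generates `B` over `A` up to the denominator `s` and `P` generates the relations of `θ`
up to its leading coefficient, then extensions of a homomorphism `χ : A → k` to `B` correspond to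
the roots of `P`. -/
theorem bijOn_extension_roots {θ : B} {P : A[X]} {s : A}
    (hP : aeval θ P = 0) (hPdeg : ∀ q : A[X], aeval θ q = 0 → q.degree < P.degree → q = 0)
    (hs : ∀ b : B, ∃ q : A[X], aeval θ q = s • b) (χ : A →+* k) (hχs : χ s ≠ 0)
    (hχP : χ P.leadingCoeff ≠ 0) :
    Set.BijOn (fun ψ : B →+* k => ψ θ) {ψ | ψ.comp (algebraMap A B) = χ}
      {τ | (P.map χ).eval τ = 0} := by
  have heval : ∀ (ψ : B →+* k), ψ.comp (algebraMap A B) = χ → ∀ q : A[X],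
      ψ (aeval θ q) = q.eval₂ χ (ψ θ) := fun ψ hψ q => by
    rw [aeval_def, hom_eval₂, hψ]
  refine ⟨fun ψ hψ => ?_, fun ψ hψ ψ' hψ' h => ?_, fun τ hτ => ?_⟩
  · change (P.map χ).eval (ψ θ) = 0
    rw [eval_map, ← heval ψ hψ, hP, map_zero]
  · ext b
    obtain ⟨q, hq⟩ := hs b
    have e : ∀ (ψ : B →+* k), ψ.comp (algebraMap A B) = χ → χ s * ψ b = q.eval₂ χ (ψ θ) :=
      fun ψ hψ => by rw [← heval ψ hψ, hq, Algebra.smul_def, map_mul, ← hψ]; rfl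
    refine mul_left_cancel₀ hχs ?_
    rw [e ψ hψ, e ψ' hψ']
    exact congrArg (fun x => q.eval₂ χ x) h
  · have hτ : P.eval₂ χ τ = 0 := by rw [← eval_map]; exact hτ
    -- Pseudo-division by `P`: multiplying by the leading coefficient, invertible after `χ`,
    -- replaces `q` by a relation of smaller degree. Thus evaluation at `τ` is well defined on
    -- polynomials in `θ`.
    have hker : ∀ (d : ℕ) (q : A[X]), q.natDegree < d → aeval θ q = 0 → q.eval₂ χ τ = 0 := by
      intro d
      induction d with
      | zero => intro q hq; omega
      | succ d ih =>
        intro q hq h0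
        rcases lt_or_ge q.degree P.degree with hlt | hge
        · rw [hPdeg q h0 hlt, eval₂_zero]
        · by_cases hq0 : q = 0
          · rw [hq0, eval₂_zero]
          have hP0 : P ≠ 0 := by
            rintro rfl
            simp at hχP
          have hnat : P.natDegree ≤ q.natDegree := natDegree_le_natDegree hge
          let q' := C P.leadingCoeff * q -
            C q.leadingCoeff * X ^ (q.natDegree - P.natDegree) * P
          have h1 : aeval θ q' = 0 := by simp [q', h0, hP]
          have h2 : q'.eval₂ χ τ = χ P.leadingCoeff * q.eval₂ χ τ := by
            simp [q', eval₂_sub, eval₂_mul, hτ]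
          have h3 : q'.eval₂ χ τ = 0 := by
            -- For constants the leading terms cancel to zero exactly, but the degree cannot drop
            -- further, so this case is separate.
            by_cases hd : q.natDegree = 0
            · have hPd : P.natDegree = 0 := by omega
              have : q' = 0 := by
                obtain ⟨x, hx⟩ := natDegree_eq_zero.1 hd
                obtain ⟨y, hy⟩ := natDegree_eq_zero.1 hPd
                simp only [q', ← hx, ← hy, leadingCoeff_C, natDegree_C, Nat.sub_self, pow_zero,
                  mul_one]
                rw [mul_comm, sub_self]
              rw [this, eval₂_zero]
            · refine ih q' ?_ h1
              refine lt_of_lt_of_le ?_ (Nat.lt_succ_iff.1 hq)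
              refine lt_of_le_of_ne ?_ ?_
              · refine (natDegree_sub_le _ _).trans (max_le ?_ ?_)
                · exact natDegree_C_mul_le _ _
                · refine natDegree_mul_le.trans ?_
                  have := natDegree_C_mul_X_pow_le q.leadingCoeff (q.natDegree - P.natDegree)
                  omega
              · intro heq
                have hc : q'.coeff q.natDegree = 0 := by
                  simp only [q', coeff_sub, coeff_C_mul, mul_assoc, coeff_X_pow_mul']
                  rw [if_pos (Nat.sub_le _ _), Nat.sub_sub_self hnat, coeff_natDegree,
                    coeff_natDegree]
                  ring
                rw [← heq, coeff_natDegree, leadingCoeff_eq_zero] at hc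
                rw [hc, natDegree_zero] at heq
                exact hd heq.symm
          rw [h2] at h3
          exact (mul_eq_zero.1 h3).resolve_left hχP
    have hwd : ∀ q q' : A[X], aeval θ q = aeval θ q' → q.eval₂ χ τ = q'.eval₂ χ τ := by
      intro q q' h
      have := hker _ (q - q') (Nat.lt_succ_self _) (by rw [map_sub, h, sub_self])
      rwa [eval₂_sub, sub_eq_zero] at this
    choose r hr using hs
    have hg : ∀ q b, aeval θ q = s • b → q.eval₂ χ τ = (r b).eval₂ χ τ := fun q b h =>
      hwd _ _ (h.trans (hr b).symm)
    have hg1 : ∀ x : A, (r (algebraMap A B x)).eval₂ χ τ = χ s * χ x := fun x => by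
      rw [← hg (C (s * x)) _ (by simp [Algebra.smul_def])]
      simp
    -- Every `b` is a polynomial in `θ` divided by `s`, which dictates the extension sending `θ` to
    -- `τ`.
    let ψ : B →+* k :=
      { toFun := fun b => (r b).eval₂ χ τ / χ s
        map_one' := by
          have := hg1 1
          rw [map_one, map_one, mul_one] at this
          rw [this, div_self hχs]
        map_mul' := fun b b' => by
          have h1 : (r b * r b').eval₂ χ τ = (C s * r (b * b')).eval₂ χ τ := by
            refine hwd _ _ ?_
            simp only [map_mul, hr, aeval_C, Algebra.smul_def]
            ring
          rw [eval₂_mul, eval₂_mul, eval₂_C] at h1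
          rw [div_mul_div_comm, h1, mul_div_mul_left _ _ hχs]
        map_zero' := by
          have := hg1 0
          rw [map_zero, map_zero, mul_zero] at this
          rw [this, zero_div]
        map_add' := fun b b' => by
          rw [← hg (r b + r b') _ (by rw [map_add, hr, hr, smul_add]), eval₂_add, add_div] }
    refine ⟨ψ, ?_, ?_⟩
    · ext x
      change (r (algebraMap A B x)).eval₂ χ τ / χ s = χ x
      rw [hg1, mul_div_cancel_left₀ _ hχs]
    · change (r θ).eval₂ χ τ / χ s = τ
      rw [← hg (C s * X) θ (by simp [Algebra.smul_def])]
      simp [eval₂_mul, hχs]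

theorem exists_smul_eq_map {A K : Type*} [CommRing A] [IsDomain A] [Field K] [Algebra A K]
    [IsFractionRing A K] (p : K[X]) :
    ∃ (s : A) (P : A[X]), s ≠ 0 ∧ P.map (algebraMap A K) = C (algebraMap A K s) * p := by
  obtain ⟨s, hs, h⟩ := IsLocalization.integerNormalization_spec (nonZeroDivisors A) p
  refine ⟨s, _, nonZeroDivisors.ne_zero hs, h.trans ?_⟩
  rw [← IsScalarTower.algebraMap_smul K s p, smul_eq_C_mul]

/-- For a finite extension of domains of characteristic zero, the number of extensions of a
general homomorphism to an algebraically closed field is constant. -/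
theorem exists_encard_extension_eq [IsDomain A] [IsDomain B] [FaithfulSMul A B]
    [Module.Finite A B] [CharZero A] [IsAlgClosed k] :
    ∃ (a : A) (d : ℕ), a ≠ 0 ∧ ∀ χ : A →+* k, χ a ≠ 0 →
      {ψ : B →+* k | ψ.comp (algebraMap A B) = χ}.encard = d := by
  let K := FractionRing A
  let M := FractionRing B
  let _ : Algebra K M := FractionRing.liftAlgebra A M
  have : IsScalarTower A K M := FractionRing.isScalarTower_liftAlgebra A M
  have : Algebra.IsAlgebraic K M := isAlgebraic_of_isFractionRing A B K M
  have : IsLocalization (Algebra.algebraMapSubmonoid B (nonZeroDivisors A)) M := inferInstance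
  have : FiniteDimensional K M := .of_isLocalization A B (nonZeroDivisors A)
  have : CharZero K := charZero_of_injective_algebraMap (IsFractionRing.injective A K)
  have hAM : ∀ x : A, algebraMap B M (algebraMap A B x) = algebraMap K M (algebraMap A K x) :=
    fun x => by rw [← IsScalarTower.algebraMap_apply, ← IsScalarTower.algebraMap_apply]
  have hBM := IsFractionRing.injective B M
  have hAK := IsFractionRing.injective A K
  -- A primitive element of the fraction fields, rescaled by an element of `A` to lie in `B`.
  obtain ⟨α, hα⟩ := Field.exists_primitive_element K M
  obtain ⟨θ, t, ht, hθ⟩ : ∃ (θ : B) (t : A), t ≠ 0 ∧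
      algebraMap B M θ = algebraMap K M (algebraMap A K t) * α := by
    obtain ⟨⟨θ, ⟨_, ⟨t, ht, rfl⟩⟩⟩, h⟩ := IsLocalization.surj
      (Algebra.algebraMapSubmonoid B (nonZeroDivisors A)) α
    exact ⟨θ, t, nonZeroDivisors.ne_zero ht, by rw [← h, ← hAM, mul_comm]⟩
  set θ' := algebraMap B M θ with hθ'
  have htK : algebraMap A K t ≠ 0 := fun h => ht (hAK (by rw [h, map_zero]))
  have hθtop : IntermediateField.adjoin K {θ'} = ⊤ := by
    rw [eq_top_iff, ← hα, IntermediateField.adjoin_simple_le_iff]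
    have h1 : α = (algebraMap A K t)⁻¹ • θ' := by
      rw [hθ, Algebra.smul_def, map_inv₀, inv_mul_cancel_left₀]
      exact (_root_.map_ne_zero _).2 htK
    rw [h1]
    exact IntermediateField.smul_mem _ (IntermediateField.mem_adjoin_simple_self K θ')
  have hgen : ∀ z : M, ∃ r : K[X], aeval θ' r = z := by
    intro z
    have hz : z ∈ IntermediateField.adjoin K {θ'} := hθtop ▸ IntermediateField.mem_top
    have h1 : z ∈ (IntermediateField.adjoin K {θ'}).toSubalgebra := hz
    rw [IntermediateField.adjoin_simple_toSubalgebra_of_isAlgebraic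
      (Algebra.IsAlgebraic.isAlgebraic θ'), Algebra.adjoin_singleton_eq_range_aeval] at h1
    exact h1
  have haeval : ∀ q : A[X], algebraMap B M (aeval θ q) = aeval θ' (q.map (algebraMap A K)) :=
    fun q => by
      rw [aeval_map_algebraMap, hθ', aeval_algebraMap_apply]
  have hint : IsIntegral K θ' := (Algebra.IsAlgebraic.isAlgebraic θ').isIntegral
  set p := minpoly K θ'
  obtain ⟨c, P, hc, hPp⟩ := exists_smul_eq_map (A := A) p
  have hcK : algebraMap A K c ≠ 0 := fun h => hc (hAK (by rw [h, map_zero]))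
  have hPdeg' : P.degree = p.degree := by
    rw [← degree_map_eq_of_injective hAK, hPp, degree_C_mul hcK]
  have hP : aeval θ P = 0 := hBM (by rw [haeval, hPp, map_mul, minpoly.aeval, mul_zero, map_zero])
  have hPdeg : ∀ q : A[X], aeval θ q = 0 → q.degree < P.degree → q = 0 := by
    intro q hq hlt
    by_contra hq0
    have h1 : q.map (algebraMap A K) ≠ 0 := (Polynomial.map_ne_zero_iff hAK).2 hq0
    have h2 := minpoly.degree_le_of_ne_zero K θ' h1 (by rw [← haeval, hq, map_zero])
    rw [degree_map_eq_of_injective hAK] at h2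
    exact absurd (hPdeg' ▸ hlt) (not_lt.2 h2)
  have hP0 : P ≠ 0 := by
    rintro rfl
    rw [degree_zero, eq_comm, degree_eq_bot] at hPdeg'
    exact minpoly.ne_zero hint hPdeg'
  obtain ⟨s, hs0, hs⟩ : ∃ s : A, s ≠ 0 ∧ ∀ b : B, ∃ q : A[X], aeval θ q = s • b := by
    classical
    have h1 : ∀ b : B, ∃ s : A, s ≠ 0 ∧ ∃ q : A[X], aeval θ q = s • b := by
      intro b
      obtain ⟨r, hr⟩ := hgen (algebraMap B M b)
      obtain ⟨s, q, hs, hq⟩ := exists_smul_eq_map (A := A) r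
      refine ⟨s, hs, q, hBM ?_⟩
      rw [haeval, hq, map_mul, hr, aeval_C, Algebra.smul_def, map_mul, hAM]
    choose s hs0 hs using h1
    -- The product of the denominators of finitely many module generators serves all of `B`.
    obtain ⟨G, hG⟩ := Module.Finite.fg_top (R := A) (M := B)
    refine ⟨∏ g ∈ G, s g, Finset.prod_ne_zero_iff.2 fun g _ => hs0 g, fun b => ?_⟩
    have h2 : (⊤ : Submodule A B) ≤ (Subalgebra.toSubmodule (aeval (R := A) θ).range).comap
        (LinearMap.lsmul A B (∏ g ∈ G, s g)) := by
      rw [← hG, Submodule.span_le]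
      intro g hg
      obtain ⟨q, hq⟩ := hs g
      refine ⟨C (∏ g ∈ G.erase g, s g) * q, ?_⟩
      change aeval θ _ = (∏ g ∈ G, s g) • g
      rw [map_mul, hq, aeval_C, ← Finset.prod_erase_mul _ _ hg, ← Algebra.smul_def, smul_smul]
    exact h2 (Submodule.mem_top (x := b))
  -- The Bézout identity for the separable minimal polynomial, with denominators cleared. Where `χ e
  -- ≠ 0` it specializes, so the roots of `P.map χ` are simple and their number is the degree of
  -- `P`.
  obtain ⟨e, U, W, he, hUW⟩ : ∃ (e : A) (U W : A[X]), e ≠ 0 ∧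
      U * P + W * derivative P = C e := by
    have hsep : p.Separable := Algebra.IsSeparable.isSeparable K θ'
    obtain ⟨u, w, huw⟩ := hsep
    obtain ⟨e₁, U, he₁, hU⟩ := exists_smul_eq_map (A := A) u
    obtain ⟨e₂, W, he₂, hW⟩ := exists_smul_eq_map (A := A) w
    refine ⟨e₁ * e₂ * c, C e₂ * U, C e₁ * W, mul_ne_zero (mul_ne_zero he₁ he₂) hc, ?_⟩
    apply Polynomial.map_injective _ hAK
    simp only [Polynomial.map_add, Polynomial.map_mul, Polynomial.map_C, ← derivative_map, hU, hW,
      hPp, derivative_C_mul, map_mul]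
    linear_combination (C (algebraMap A K e₁) * C (algebraMap A K e₂) * C (algebraMap A K c)) * huw
  refine ⟨s * P.leadingCoeff * e, P.natDegree,
    mul_ne_zero (mul_ne_zero hs0 (leadingCoeff_ne_zero.2 hP0)) he, fun χ hχ => ?_⟩
  rw [map_mul, map_mul] at hχ
  have hχe := right_ne_zero_of_mul hχ
  have hχP := right_ne_zero_of_mul (left_ne_zero_of_mul hχ)
  have hbij := bijOn_extension_roots hP hPdeg hs χ (left_ne_zero_of_mul (left_ne_zero_of_mul hχ)) hχP
  rw [← hbij.injOn.encard_image, hbij.image_eq]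
  have hPχ : P.map χ ≠ 0 := fun h => hχP (by
    rw [← coeff_natDegree, ← coeff_map, h, coeff_zero])
  have hsep : (P.map χ).Separable := by
    refine ⟨C (χ e)⁻¹ * U.map χ, C (χ e)⁻¹ * W.map χ, ?_⟩
    have := congrArg (Polynomial.map χ) hUW
    rw [Polynomial.map_add, Polynomial.map_mul, Polynomial.map_mul, ← derivative_map,
      Polynomial.map_C] at this
    rw [mul_assoc, mul_assoc, ← mul_add, this, ← C_mul, inv_mul_cancel₀ hχe, C_1]
  have hroots : {τ | (P.map χ).eval τ = 0} = (P.map χ).rootSet k := by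
    ext τ
    simp [mem_rootSet, hPχ]
  rw [hroots, ← Set.coe_fintypeCard, card_rootSet_eq_natDegree hsep (IsAlgClosed.splits _),
    natDegree_map_of_leadingCoeff_ne_zero _ hχP]

end GenericFibre


/-! ### Fibres of finite polynomial maps; parity -/

section PolynomialFibres

open MvPolynomial

/-- The fibres of a finite polynomial map have constant cardinality over a nonempty open set. -/
theorem exists_encard_fibre_eq {σ : Type*} [Finite σ] (A : Subalgebra ℂ (MvPolynomial σ ℂ))
    [Algebra.IsIntegral A (MvPolynomial σ ℂ)] :
    ∃ (a : A) (d : ℕ), a ≠ 0 ∧ ∀ x : σ → ℂ, eval x (a : MvPolynomial σ ℂ) ≠ 0 →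
      {y : σ → ℂ | ∀ f ∈ A, eval y f = eval x f}.encard = d := by
  have : Algebra.FiniteType A (MvPolynomial σ ℂ) := .of_restrictScalars_finiteType ℂ A _
  have : Module.Finite A (MvPolynomial σ ℂ) := Algebra.IsIntegral.finite
  obtain ⟨a, d, ha, h⟩ := exists_encard_extension_eq (A := A) (B := MvPolynomial σ ℂ) (k := ℂ)
  refine ⟨a, d, ha, fun x hx => ?_⟩
  rw [← h ((eval x).comp (algebraMap A (MvPolynomial σ ℂ))) hx]
  have hinj : Function.Injective fun y : σ → ℂ => (eval y : MvPolynomial σ ℂ →+* ℂ) := by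
    intro y z hyz
    ext i
    simpa using congrArg (fun ψ : MvPolynomial σ ℂ →+* ℂ => ψ (X i)) hyz
  rw [← hinj.encard_image]
  congr 1
  ext ψ
  constructor
  · rintro ⟨y, hy, rfl⟩
    ext f
    exact hy f f.2
  · intro hψ
    have hψA : ∀ f ∈ A, ψ f = eval x f := fun f hf => RingHom.congr_fun hψ ⟨f, hf⟩
    -- A ring homomorphism extending `eval x` on `A` fixes the constants, as these lie in `A`; it is
    -- therefore evaluation at a point.
    have he : eval (fun i => ψ (X i)) = ψ := by
      refine MvPolynomial.ringHom_ext (fun c => ?_) fun i => by simp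
      have := hψA (C c) (A.algebraMap_mem c)
      rw [this, eval_C, eval_C]
    exact ⟨fun i => ψ (X i), fun f hf => by rw [he, hψA f hf], he⟩

/-- A finite set with a fixed-point free involution has even cardinality. -/
theorem Set.even_of_encard_eq_of_involution {α : Type*} {s : Set α} {d : ℕ} (hs : s.encard = d)
    (τ : α → α) (hτ : ∀ x ∈ s, τ x ∈ s) (hinv : ∀ x ∈ s, τ (τ x) = x) (hne : ∀ x ∈ s, τ x ≠ x) :
    Even d := by
  classical
  have hfin : s.Finite := Set.finite_of_encard_eq_coe hs
  have h1 : ∑ x ∈ hfin.toFinset, (1 : ZMod 2) = 0 :=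
    Finset.sum_involution (fun x _ => τ x) (fun x _ => by decide)
      (fun x hx _ => hne x (hfin.mem_toFinset.1 hx))
      (fun x hx => hfin.mem_toFinset.2 (hτ x (hfin.mem_toFinset.1 hx)))
      (fun x hx => hinv x (hfin.mem_toFinset.1 hx))
  rw [Finset.sum_const, nsmul_one, ZMod.natCast_eq_zero_iff] at h1
  rw [hfin.encard_eq_coe_toFinset_card] at hs
  have : hfin.toFinset.card = d := by exact_mod_cast hs
  exact even_iff_two_dvd.2 (this ▸ h1)

end PolynomialFibres

/-! ### Finiteness of the Wronski map on a chart -/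

section Chart

open MvPolynomial

variable {m : ℕ} {T : Type*}

/-- The generic `m × m` matrix. -/
abbrev genericMatrix (m : ℕ) : Matrix (Fin m) (Fin m) (MvPolynomial (Fin m × Fin m) ℂ) :=
  Matrix.of fun i j => X (i, j)

/-- The polynomial `det (A + Z B) / det A₀` in the entries of `Z`. -/
def chartPoly (A₀ A B : Matrix (Fin m) (Fin m) ℂ) : MvPolynomial (Fin m × Fin m) ℂ :=
  C A₀.det⁻¹ * (A.map C + genericMatrix m * B.map C).det

theorem eval_chartPoly (A₀ A B : Matrix (Fin m) (Fin m) ℂ) (Z : Fin m × Fin m → ℂ) :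
    eval Z (chartPoly A₀ A B) = (A + Matrix.of (fun i j => Z (i, j)) * B).det / A₀.det := by
  rw [chartPoly, map_mul, eval_C, RingHom.map_det, div_eq_inv_mul]
  congr 2
  ext i j
  simp [Matrix.mul_apply]

/-- The polynomial `det (X A + Y B)` in the entries of the matrix `(X | Y)`. -/
def frameDet (A B : Matrix (Fin m) (Fin m) ℂ) : MvPolynomial (Fin m × (Fin m ⊕ Fin m)) ℂ :=
  (Matrix.of (fun i j => X (i, Sum.inl j)) * A.map C +
    Matrix.of (fun i j => X (i, Sum.inr j)) * B.map C).det

theorem aeval_frameDet {S : Type*} [CommRing S] [Algebra ℂ S] (A B : Matrix (Fin m) (Fin m) ℂ)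
    (w : Fin m × (Fin m ⊕ Fin m) → S) :
    aeval w (frameDet A B) = (Matrix.of (fun i j => w (i, Sum.inl j)) * A.map (algebraMap ℂ S) +
      Matrix.of (fun i j => w (i, Sum.inr j)) * B.map (algebraMap ℂ S)).det := by
  rw [frameDet, AlgHom.map_det]
  congr 1
  ext i j
  simp [Matrix.mul_apply]

/-- No nondegenerate matrix over an extension field is killed by a family of determinants that has
no nondegenerate common zero over `ℂ`. -/
theorem exists_det_ne_zero_of_extension {A B : T → Matrix (Fin m) (Fin m) ℂ}
    (hAB : ∀ X Y : Matrix (Fin m) (Fin m) ℂ,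
      LinearIndependent ℂ (fun i => Sum.elim (X i) (Y i)) → ∃ t, (X * A t + Y * B t).det ≠ 0)
    {F : Type*} [Field F] [Algebra ℂ F] (W : Fin m → Fin m ⊕ Fin m → F)
    (s : Fin m → Fin m ⊕ Fin m) (hW : ∀ i j, W i (s j) = (1 : Matrix (Fin m) (Fin m) F) i j) :
    ∃ t, (Matrix.of (fun i j => W i (Sum.inl j)) * (A t).map (algebraMap ℂ F) +
      Matrix.of (fun i j => W i (Sum.inr j)) * (B t).map (algebraMap ℂ F)).det ≠ 0 := by
  by_contra! h
  let N : Fin m × Fin m → MvPolynomial (Fin m × (Fin m ⊕ Fin m)) ℂ := fun p =>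
    X (p.1, s p.2) - C ((1 : Matrix (Fin m) (Fin m) ℂ) p.1 p.2)
  let J : Ideal (MvPolynomial (Fin m × (Fin m ⊕ Fin m)) ℂ) :=
    Ideal.span (Set.range (fun t => frameDet (A t) (B t)) ∪ Set.range N)
  -- The equations `N` put the identity matrix in the columns `s`, so the rows of a common zero are
  -- independent, contradicting `hAB`. By the Nullstellensatz the ideal is then the unit ideal,
  -- which has no zeros over any extension field.
  have hJ : zeroLocus ℂ J = ∅ := by
    rw [Set.eq_empty_iff_forall_notMem]
    intro w hw
    rw [zeroLocus_span] at hw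
    have hN : ∀ i j, w (i, s j) = (1 : Matrix (Fin m) (Fin m) ℂ) i j := fun i j => by
      have := hw (N (i, j)) (Or.inr ⟨(i, j), rfl⟩)
      simpa [N, sub_eq_zero] using this
    obtain ⟨t, ht⟩ := hAB (Matrix.of fun i j => w (i, Sum.inl j))
      (Matrix.of fun i j => w (i, Sum.inr j)) (by
        rw [Fintype.linearIndependent_iff]
        intro g hg j
        have h1 := congrFun hg (s j)
        have h2 : ∀ i, Sum.elim ((Matrix.of fun i j => w (i, Sum.inl j)) i)
            ((Matrix.of fun i j => w (i, Sum.inr j)) i) (s j) = w (i, s j) := fun i => by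
          rcases s j with l | l <;> rfl
        simpa [h2, hN, Matrix.one_apply] using h1)
    have := hw (frameDet (A t) (B t)) (Or.inl ⟨t, rfl⟩)
    rw [aeval_frameDet] at this
    exact ht (by simpa using this)
  have hJtop : J = ⊤ := by
    have := vanishingIdeal_zeroLocus_eq_radical (K := ℂ) J
    rw [hJ, vanishingIdeal_empty] at this
    exact Ideal.radical_eq_top.1 this.symm
  have hker : J ≤ RingHom.ker (aeval (R := ℂ) fun p : Fin m × (Fin m ⊕ Fin m) => W p.1 p.2) := by
    refine Ideal.span_le.2 ?_
    rintro _ (⟨t, rfl⟩ | ⟨⟨i, j⟩, rfl⟩)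
    · rw [SetLike.mem_coe, RingHom.mem_ker, aeval_frameDet]
      exact h t
    · rw [SetLike.mem_coe, RingHom.mem_ker]
      simp [N, hW, Matrix.one_apply]
  rw [hJtop, top_le_iff, Ideal.eq_top_iff_one, RingHom.mem_ker, map_one] at hker
  exact one_ne_zero hker

/-- The entries of a matrix `z` over a field lie in any valuation ring that contains the Wronskian
coordinates `det (A t + z B t)`: the emptiness of the base locus makes the chart proper. -/
theorem mem_valuationSubring_of_det_mem {A B : T → Matrix (Fin m) (Fin m) ℂ}
    (hAB : ∀ X Y : Matrix (Fin m) (Fin m) ℂ,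
      LinearIndependent ℂ (fun i => Sum.elim (X i) (Y i)) → ∃ t, (X * A t + Y * B t).det ≠ 0)
    {K : Type*} [Field K] [Algebra ℂ K] (V : ValuationSubring K) (hC : ∀ c, algebraMap ℂ K c ∈ V)
    (z : Matrix (Fin m) (Fin m) K)
    (hF : ∀ t, ((A t).map (algebraMap ℂ K) + z * (B t).map (algebraMap ℂ K)).det ∈ V)
    (i j : Fin m) : z i j ∈ V := by
  let G : Matrix (Fin m) (Fin m ⊕ Fin m) K :=
    Matrix.of fun i => Sum.elim ((1 : Matrix (Fin m) (Fin m) K) i) (z i)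
  let minor : (Fin m → Fin m ⊕ Fin m) → K := fun s => (G.submatrix id s).det
  -- Normalize the frame `(1 | z)` at a maximal minor of largest valuation. By Cramer's rule the
  -- entries of the normalized frame `W` are quotients of minors by this one, hence integral, and
  -- `W` can be reduced to the residue field.
  obtain ⟨s, hs⟩ := Finite.exists_max fun s => V.valuation (minor s)
  have hupd : ∀ (s : Fin m → Fin m ⊕ Fin m) (k : Fin m) (c : Fin m ⊕ Fin m),
      Matrix.cramer (G.submatrix id s) (fun i => G i c) k = minor (Function.update s k c) := by
    intro s k c
    rw [Matrix.cramer_apply]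
    congr 1
    ext a l
    rw [Matrix.updateCol_apply]
    change (if l = k then G a c else G a (s l)) = G a (Function.update s k c l)
    by_cases h : l = k <;> simp [h]
  have hinl : G.submatrix id Sum.inl = 1 := by
    ext a l
    rfl
  have hone : V.valuation (minor Sum.inl) = 1 := by
    simp only [minor, hinl, Matrix.det_one, map_one]
  have hs1 : 1 ≤ V.valuation (minor s) := hone ▸ hs Sum.inl
  have hs0 : minor s ≠ 0 := fun h => by
    rw [h, map_zero] at hs1
    exact absurd hs1 (not_le.2 zero_lt_one)
  have hunit : IsUnit (G.submatrix id s).det := isUnit_iff_ne_zero.2 hs0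
  let g : Matrix (Fin m) (Fin m) K := (G.submatrix id s)⁻¹
  let W : Matrix (Fin m) (Fin m ⊕ Fin m) K := g * G
  have hWs : ∀ k l, W k (s l) = (1 : Matrix (Fin m) (Fin m) K) k l := fun k l =>
    congrFun (congrFun (Matrix.nonsing_inv_mul _ hunit) k) l
  have hWV : ∀ k c, W k c ∈ V := by
    intro k c
    have h1 := congrFun (Matrix.det_smul_inv_mulVec_eq_cramer (G.submatrix id s)
      (fun i => G i c) hunit) k
    rw [hupd] at h1
    have h2 : minor s * W k c = minor (Function.update s k c) := h1
    rw [← V.valuation_le_one_iff]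
    have h3 := hs (Function.update s k c)
    simp only [← h2, map_mul] at h3
    exact le_of_mul_le_mul_left (by rwa [mul_one]) (zero_lt_one.trans_le hs1)
  let ι : ℂ →+* V := (algebraMap ℂ K).codRestrict V.toSubring hC
  let _ : Algebra ℂ (IsLocalRing.ResidueField V) := ((IsLocalRing.residue V).comp ι).toAlgebra
  let W' : Fin m → Fin m ⊕ Fin m → V := fun k c => ⟨W k c, hWV k c⟩
  obtain ⟨t, ht⟩ := exists_det_ne_zero_of_extension hAB
    (fun k c => IsLocalRing.residue V (W' k c)) s (fun k l => by
      have : W' k (s l) = (1 : Matrix (Fin m) (Fin m) V) k l := by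
        apply Subtype.ext
        change W k (s l) = _
        rw [hWs, Matrix.one_apply, Matrix.one_apply]
        split_ifs <;> rfl
      rw [this, Matrix.one_apply, Matrix.one_apply]
      split_ifs <;> simp)
  let d : V := (Matrix.of (fun i j => W' i (Sum.inl j)) * (A t).map ι +
    Matrix.of (fun i j => W' i (Sum.inr j)) * (B t).map ι).det
  have hd : IsLocalRing.residue V d ≠ 0 := by
    convert ht using 1
    rw [RingHom.map_det]
    congr 1
    ext k l
    simp only [RingHom.mapMatrix_apply, Matrix.map_apply, Matrix.add_apply, Matrix.mul_apply,
      map_add, map_mul, Matrix.of_apply]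
    rfl
  -- The Wronskian coordinate of `W` at `t` is a unit, since its residue is nonzero, and differs
  -- from that of `(1 | z)` by the factor `det g`. So the largest minor has the valuation of an
  -- element of `V`, and all minors, among them the entries of `z`, lie in `V`.
  have hdK : (d : K) = g.det *
      ((A t).map (algebraMap ℂ K) + z * (B t).map (algebraMap ℂ K)).det := by
    rw [← Matrix.det_mul]
    change V.subtype d = _
    rw [RingHom.map_det, mul_add, ← mul_assoc]
    congr 2
    · ext k l
      simp only [RingHom.mapMatrix_apply, Matrix.map_apply, Matrix.add_apply, Matrix.mul_apply,
        map_add, map_mul, Matrix.of_apply]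
      congr 1
      refine Finset.sum_congr rfl fun a _ => ?_
      congr 1
      change ∑ x, g k x * (1 : Matrix (Fin m) (Fin m) K) x a = g k a
      rw [← Matrix.mul_apply, mul_one]
  have hdv : V.valuation (d : K) = 1 := by
    rw [ne_eq, IsLocalRing.residue_eq_zero_iff, IsLocalRing.mem_maximalIdeal, mem_nonunits_iff,
      not_not] at hd
    exact (V.valuation_eq_one_iff d).1 hd
  have hgdet : g.det * minor s = 1 := by
    rw [← Matrix.det_mul, Matrix.nonsing_inv_mul _ hunit, Matrix.det_one]
  have hsle : V.valuation (minor s) ≤ 1 := by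
    have h1 := (V.valuation_le_one_iff _).2 (hF t)
    have h2 : V.valuation g.det * V.valuation (minor s) = 1 := by rw [← map_mul, hgdet, map_one]
    rw [hdK, map_mul] at hdv
    calc V.valuation (minor s) = V.valuation (minor s) * (V.valuation g.det *
          V.valuation ((A t).map (algebraMap ℂ K) + z * (B t).map (algebraMap ℂ K)).det) := by
          rw [hdv, mul_one]
      _ = V.valuation ((A t).map (algebraMap ℂ K) + z * (B t).map (algebraMap ℂ K)).det := by
          rw [← mul_assoc, mul_comm (V.valuation (minor s)), h2, one_mul]
      _ ≤ 1 := h1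
  have hz : z i j = minor (Function.update Sum.inl i (Sum.inr j)) := by
    rw [← hupd, hinl, Matrix.cramer_one]
    rfl
  rw [← V.valuation_le_one_iff, hz]
  exact (hs _).trans hsle

/-- The entries of the generic matrix are integral over the Wronskian coordinates. -/
theorem isIntegral_adjoin_chartPoly {A B : T → Matrix (Fin m) (Fin m) ℂ}
    (hAB : ∀ X Y : Matrix (Fin m) (Fin m) ℂ,
      LinearIndependent ℂ (fun i => Sum.elim (X i) (Y i)) → ∃ t, (X * A t + Y * B t).det ≠ 0)
    {A₀ : Matrix (Fin m) (Fin m) ℂ} (hA₀ : A₀.det ≠ 0) :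
    Algebra.IsIntegral (Algebra.adjoin ℂ (Set.range fun t => chartPoly A₀ (A t) (B t)))
      (MvPolynomial (Fin m × Fin m) ℂ) := by
  set S := Algebra.adjoin ℂ (Set.range fun t => chartPoly A₀ (A t) (B t)) with hS
  let K := FractionRing (MvPolynomial (Fin m × Fin m) ℂ)
  have hX : ∀ p : Fin m × Fin m, IsIntegral S (X p : MvPolynomial (Fin m × Fin m) ℂ) := by
    intro p
    rw [← isIntegral_algebraMap_iff (IsFractionRing.injective (MvPolynomial (Fin m × Fin m) ℂ) K)]
    let R : Subring K := (algebraMap S K).range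
    have hmem : algebraMap _ K (X p : MvPolynomial (Fin m × Fin m) ℂ) ∈
        (integralClosure (Subring.closure (R : Set K)) K).toSubring := by
      -- The integral closure in a field is the intersection of the valuation rings containing the
      -- subring.
      rw [← iInf_valuationSubring_superset, Subring.mem_iInf]
      rintro ⟨V, hV⟩
      have hVS : ∀ f ∈ S, algebraMap (MvPolynomial (Fin m × Fin m) ℂ) K f ∈ V :=
        fun f hf => hV ⟨⟨f, hf⟩, rfl⟩
      have hVC : ∀ c : ℂ, algebraMap ℂ K c ∈ V := fun c => by
        rw [IsScalarTower.algebraMap_apply ℂ (MvPolynomial (Fin m × Fin m) ℂ) K]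
        exact hVS _ (S.algebraMap_mem c)
      refine mem_valuationSubring_of_det_mem hAB V hVC
        (Matrix.of fun i j => algebraMap (MvPolynomial (Fin m × Fin m) ℂ) K (X (i, j)))
        (fun t => ?_) p.1 p.2
      have h1 : C A₀.det * chartPoly A₀ (A t) (B t) ∈ S :=
        S.mul_mem (S.algebraMap_mem _) (Algebra.subset_adjoin ⟨t, rfl⟩)
      rw [chartPoly, ← mul_assoc, ← C_mul, mul_inv_cancel₀ hA₀, C_1, one_mul] at h1
      have h2 := hVS _ h1
      rw [RingHom.map_det] at h2
      have e : (A t).map (algebraMap ℂ K) +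
          (Matrix.of fun i j => algebraMap (MvPolynomial (Fin m × Fin m) ℂ) K (X (i, j))) *
            (B t).map (algebraMap ℂ K) = (algebraMap (MvPolynomial (Fin m × Fin m) ℂ) K).mapMatrix
              ((A t).map C + genericMatrix m * (B t).map C) := by
        ext k l
        simp only [RingHom.mapMatrix_apply, Matrix.map_apply, Matrix.add_apply, Matrix.mul_apply,
          map_add, map_mul, Matrix.of_apply, ← algebraMap_eq,
          ← IsScalarTower.algebraMap_apply]
      rw [e]
      exact h2
    rw [Subring.closure_eq] at hmem
    obtain ⟨q, hq, hq0⟩ : IsIntegral R (algebraMap _ K (X p : MvPolynomial (Fin m × Fin m) ℂ)) :=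
      hmem
    have hlift : q ∈ Polynomial.lifts (algebraMap S K).rangeRestrict := by
      rw [Polynomial.lifts_iff_coeff_lifts]
      exact fun n => (algebraMap S K).rangeRestrict_surjective _
    obtain ⟨q', hq', -, hm⟩ := Polynomial.lifts_and_degree_eq_and_monic hlift hq
    refine ⟨q', hm, ?_⟩
    rw [← hq', Polynomial.eval₂_map] at hq0
    exact hq0
  refine ⟨fun f => ?_⟩
  induction f using MvPolynomial.induction_on with
  | C c => exact isIntegral_algebraMap (x := algebraMap ℂ S c)
  | add f g hf hg => exact hf.add hg
  | mul_X f p hf => exact hf.mul (hX p)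

end Chart


/-! ### Parity of the chart fibres; homogenization -/

section Assembly

open MvPolynomial

variable {m : ℕ} {T : Type*}

/-- The coordinates in `T` of the point of the chart with matrix `Z`. -/
def chartPoint (A₀ : Matrix (Fin m) (Fin m) ℂ) (A B : T → Matrix (Fin m) (Fin m) ℂ)
    (Z : Fin m × Fin m → ℂ) (t : T) : ℂ :=
  (A t + Matrix.of (fun i j => Z (i, j)) * B t).det / A₀.det

/-- Transposition of `Z` preserves the fibres, so it suffices to shrink the open set where they have
constant cardinality until they contain no symmetric matrix. -/
theorem exists_even_encard_chart_fibre (hm : 2 ≤ m) {A B : T → Matrix (Fin m) (Fin m) ℂ}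
    (hAB : ∀ X Y : Matrix (Fin m) (Fin m) ℂ,
      LinearIndependent ℂ (fun i => Sum.elim (X i) (Y i)) → ∃ t, (X * A t + Y * B t).det ≠ 0)
    {A₀ : Matrix (Fin m) (Fin m) ℂ} (hA₀ : A₀.det ≠ 0)
    (hsymm : ∀ (Z : Matrix (Fin m) (Fin m) ℂ) t,
      (A t + Z * B t).det = (A t + Z.transpose * B t).det) :
    ∃ (Q : MvPolynomial T ℂ) (d : ℕ), Even d ∧ (∃ Z, eval (chartPoint A₀ A B Z) Q ≠ 0) ∧
      ∀ Z, eval (chartPoint A₀ A B Z) Q ≠ 0 →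
        {Z' | chartPoint A₀ A B Z' = chartPoint A₀ A B Z}.encard = d := by
  set S := Algebra.adjoin ℂ (Set.range fun t => chartPoly A₀ (A t) (B t)) with hS
  have hint : Algebra.IsIntegral S (MvPolynomial (Fin m × Fin m) ℂ) :=
    isIntegral_adjoin_chartPoly hAB hA₀
  obtain ⟨a, d, ha, hd⟩ := exists_encard_fibre_eq S
  let i₀ : Fin m := ⟨0, by omega⟩
  let i₁ : Fin m := ⟨1, by omega⟩
  have hi : i₀ ≠ i₁ := by simp [i₀, i₁]
  let u : MvPolynomial (Fin m × Fin m) ℂ := X (i₀, i₁) - X (i₁, i₀)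
  have hu : u ≠ 0 := by
    rw [sub_ne_zero]
    intro h
    have := MvPolynomial.X_injective h
    simp [hi] at this
  -- A nonzero multiple of `u` in `S`, which exists by integrality. Being in `S`, it is constant on
  -- fibres; being a multiple of `u`, it vanishes at symmetric matrices. Where it is nonzero, the
  -- whole fibre avoids them.
  obtain ⟨a', ha', w, hw⟩ := (hint.isIntegral u).isAlgebraic.exists_nonzero_dvd
    (mem_nonZeroDivisors_of_ne_zero hu)
  obtain ⟨Q, hQ⟩ : ∃ Q : MvPolynomial T ℂ,
      aeval (fun t => chartPoly A₀ (A t) (B t)) Q = ((a * a' : S) : MvPolynomial _ ℂ) := by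
    have h1 : S ≤ (aeval (R := ℂ) fun t => chartPoly A₀ (A t) (B t)).range :=
      (Algebra.adjoin_range_eq_range_aeval ℂ _).le
    exact h1 (a * a').2
  have hev : ∀ Z, eval (chartPoint A₀ A B Z) Q =
      eval Z (a : MvPolynomial (Fin m × Fin m) ℂ) * eval Z (a' : MvPolynomial _ ℂ) := by
    intro Z
    rw [← map_mul]
    change _ = eval Z ((a * a' : S) : MvPolynomial _ ℂ)
    rw [← hQ, aeval_def, hom_eval₂]
    have h1 : (eval Z).comp (algebraMap ℂ (MvPolynomial (Fin m × Fin m) ℂ)) = RingHom.id ℂ := by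
      ext c
      simp
    rw [h1]
    change eval₂ _ _ Q = _
    congr 1
    ext t
    exact (eval_chartPoly _ _ _ _).symm
  have hfib : ∀ Z, {Z' | ∀ f ∈ S, eval Z' f = eval Z f} =
      {Z' | chartPoint A₀ A B Z' = chartPoint A₀ A B Z} := by
    intro Z
    ext Z'
    constructor
    · intro h
      ext t
      have := h _ (Algebra.subset_adjoin ⟨t, rfl⟩)
      rwa [eval_chartPoly, eval_chartPoly] at this
    · intro h f hf
      have h1 : S ≤ AlgHom.equalizer (aeval (R := ℂ) Z') (aeval (R := ℂ) Z) := by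
        refine Algebra.adjoin_le ?_
        rintro _ ⟨t, rfl⟩
        have := congrFun h t
        change aeval Z' _ = aeval Z _
        rw [aeval_eq_eval, aeval_eq_eval]
        rw [eval_chartPoly, eval_chartPoly]
        exact this
      have h2 := h1 hf
      change aeval Z' f = aeval Z f at h2
      rwa [aeval_eq_eval, aeval_eq_eval] at h2
  have hcard : ∀ Z, eval (chartPoint A₀ A B Z) Q ≠ 0 →
        {Z' | chartPoint A₀ A B Z' = chartPoint A₀ A B Z}.encard = d := by
    intro Z hZ
    rw [hev] at hZ
    rw [← hfib]
    exact hd Z (left_ne_zero_of_mul hZ)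
  have hex : ∃ Z, eval (chartPoint A₀ A B Z) Q ≠ 0 := by
    by_contra! h
    have h1 : ((a * a' : S) : MvPolynomial (Fin m × Fin m) ℂ) = 0 := by
      refine MvPolynomial.funext fun Z => ?_
      rw [map_zero, ← h Z, hev, ← map_mul]
      rfl
    exact mul_ne_zero ha ha' (Subtype.ext h1)
  refine ⟨Q, d, ?_, hex, hcard⟩
  obtain ⟨Z, hZ⟩ := hex
  have hfix : ∀ Y ∈ {Z' | chartPoint A₀ A B Z' = chartPoint A₀ A B Z}, Y ∘ Prod.swap ≠ Y := by
    intro Y hY h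
    rw [← (show chartPoint A₀ A B Y = chartPoint A₀ A B Z from hY), hev] at hZ
    have h1 : eval Y (a' : MvPolynomial (Fin m × Fin m) ℂ) = 0 := by
      change eval Y (algebraMap S _ a') = 0
      have h2 : Y (i₁, i₀) = Y (i₀, i₁) := congrFun h (i₀, i₁)
      rw [hw, map_mul]
      simp [u, h2]
    exact right_ne_zero_of_mul hZ h1
  refine Set.even_of_encard_eq_of_involution (hcard Z hZ) (fun Y => Y ∘ Prod.swap)
    (fun Y hY => ?_) (fun Y _ => ?_) hfix
  · refine Eq.trans (funext fun t => ?_) hY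
    exact congrArg (· / A₀.det) (hsymm (Matrix.of fun i j => Y (i, j)) t).symm
  · ext p
    rfl

/-- Homogenization of a polynomial with respect to one of the coordinates. -/
theorem exists_homogenization (Q : MvPolynomial T ℂ) (t₀ : T) :
    ∃ (P : MvPolynomial T ℂ) (D : ℕ), P.IsHomogeneous D ∧
      (∀ g : T → ℂ, g t₀ = 0 → eval g P = 0) ∧
      ∀ (c : ℂ) (g : T → ℂ), g t₀ = 1 → eval (c • g) P = c ^ D * eval g Q := by
  -- Homogenizing to one degree more than needed puts a factor `X t₀` in every term, so that the
  -- result vanishes wherever `g t₀ = 0`.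
  refine ⟨∑ k ∈ Finset.range (Q.totalDegree + 1),
    X t₀ ^ (Q.totalDegree + 1 - k) * homogeneousComponent k Q, Q.totalDegree + 1, ?_, ?_, ?_⟩
  · refine IsHomogeneous.sum _ _ _ fun k hk => ?_
    have h1 := (isHomogeneous_X_pow (R := ℂ) t₀ (Q.totalDegree + 1 - k)).mul
      (homogeneousComponent_isHomogeneous k Q)
    rwa [Nat.sub_add_cancel (Finset.mem_range.1 hk).le] at h1
  · intro g hg
    rw [map_sum]
    refine Finset.sum_eq_zero fun k hk => ?_
    have := Finset.mem_range.1 hk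
    rw [map_mul, map_pow, eval_X, hg, zero_pow (by omega), zero_mul]
  · intro c g hg
    have hsum : eval g Q = ∑ k ∈ Finset.range (Q.totalDegree + 1),
        eval g (homogeneousComponent k Q) := by
      rw [← map_sum, sum_homogeneousComponent]
    rw [map_sum, hsum, Finset.mul_sum]
    refine Finset.sum_congr rfl fun k hk => ?_
    have h1 : eval (c • g) (homogeneousComponent k Q) =
        c ^ k * eval g (homogeneousComponent k Q) := by
      rw [eval_eq, eval_eq, Finset.mul_sum]
      refine Finset.sum_congr rfl fun e he => ?_
      have h2 := homogeneousComponent_isHomogeneous k Q (mem_support_iff.1 he)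
      rw [Finsupp.weight_apply, Finsupp.sum] at h2
      simp only [Pi.one_apply, smul_eq_mul, mul_one] at h2
      simp only [Pi.smul_apply, smul_eq_mul, mul_pow, Finset.prod_mul_distrib,
        Finset.prod_pow_eq_pow_sum, h2]
      ring
    rw [map_mul, map_pow, eval_X, h1, Pi.smul_apply, hg, smul_eq_mul, mul_one, ← mul_assoc,
      ← pow_add, Nat.sub_add_cancel (Finset.mem_range.1 hk).le]

end Assembly

/-! ### The chart of the Grassmannian around an adapted basis -/

namespace LinDiffOp

open MvPolynomial

variable {I : Set ℝ} {n m : ℕ} (L : LinDiffOp I n) (hI : IsOpen I)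
  {b : Module.Basis (Fin m ⊕ Fin m) ℂ (L.solutionSpace hI)} {t₀ : I}

theorem wronskian_linearCombination
    (b : Module.Basis (Fin m ⊕ Fin m) ℂ (L.solutionSpace hI))
    (X Y : Matrix (Fin m) (Fin m) ℂ) (t : I) :
    wronskian I (fun i => ((∑ j, X i j • b (Sum.inl j) + ∑ j, Y i j • b (Sum.inr j) :
      L.solutionSpace hI) : ℝ → ℂ)) t =
      (X * L.jetMatrix hI (b ∘ Sum.inl) t + Y * L.jetMatrix hI (b ∘ Sum.inr) t).det := by
  rw [← L.jetMatrix_linearCombination hI b, det_jetMatrix]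

/-- The absence of base points in matrix form, as needed for the finiteness of the chart. -/
theorem exists_det_ne_zero (hc : I.OrdConnected) (hne : I.Nonempty)
    (b : Module.Basis (Fin m ⊕ Fin m) ℂ (L.solutionSpace hI))
    (X Y : Matrix (Fin m) (Fin m) ℂ) (h : LinearIndependent ℂ fun i => Sum.elim (X i) (Y i)) :
    ∃ t, (X * L.jetMatrix hI (b ∘ Sum.inl) t + Y * L.jetMatrix hI (b ∘ Sum.inr) t).det ≠ 0 := by
  have h1 : LinearIndependent ℂ fun i => (∑ j, X i j • b (Sum.inl j) + ∑ j, Y i j • b (Sum.inr j) :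
      L.solutionSpace hI) := by
    have h2 := h.map' _ (LinearEquiv.ker b.equivFun.symm)
    have e : (fun i => (∑ j, X i j • b (Sum.inl j) + ∑ j, Y i j • b (Sum.inr j) :
        L.solutionSpace hI)) = b.equivFun.symm ∘ fun i => Sum.elim (X i) (Y i) := by
      ext i : 1
      simp [Module.Basis.equivFun_symm_apply, Fintype.sum_sum_type]
    rw [e]
    exact h2
  obtain ⟨t, ht⟩ := Function.ne_iff.1 (L.wronskian_ne_zero hI hc hne h1)
  exact ⟨t, by rwa [wronskian_linearCombination] at ht⟩

theorem det_add_mul_symm (hc : I.OrdConnected) (hb : L.IsAdapted hI b t₀)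
    (Z : Matrix (Fin m) (Fin m) ℂ) (t : I) :
    (L.jetMatrix hI (b ∘ Sum.inl) t + Z * L.jetMatrix hI (b ∘ Sum.inr) t).det =
      (L.jetMatrix hI (b ∘ Sum.inl) t + Z.transpose * L.jetMatrix hI (b ∘ Sum.inr) t).det := by
  have hcont : ∀ Z : Matrix (Fin m) (Fin m) ℂ, Continuous fun t =>
      (L.jetMatrix hI (b ∘ Sum.inl) t + Z * L.jetMatrix hI (b ∘ Sum.inr) t).det := by
    intro Z
    have h1 := L.continuous_wronskian hI fun i =>
      (∑ j, (1 : Matrix (Fin m) (Fin m) ℂ) i j • b (Sum.inl j) + ∑ j, Z i j • b (Sum.inr j))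
    convert h1 using 1
    ext t
    rw [wronskian_linearCombination, one_mul]
  refine congrFun (Continuous.ext_on (L.dense_det_ne_zero hI hc b) (hcont Z) (hcont Z.transpose)
    fun t ht => ?_) t
  obtain ⟨S, hS, hB⟩ := hb.exists_symm t ht
  exact det_add_mul_eq_det_add_transpose_mul hS hB Z

/-- The basis of the subspace with matrix `Z` in the chart given by a basis `b`. -/
def chartBasis (b : Module.Basis (Fin m ⊕ Fin m) ℂ (L.solutionSpace hI))
    (Z : Fin m × Fin m → ℂ) (i : Fin m) : L.solutionSpace hI :=
  b (Sum.inl i) + ∑ j, Z (i, j) • b (Sum.inr j)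

theorem repr_sum_chartBasis_inl (c : Fin m → ℂ) (Z : Fin m × Fin m → ℂ) (i : Fin m) :
    b.repr (∑ k, c k • L.chartBasis hI b Z k) (Sum.inl i) = c i := by
  simp [chartBasis, Finsupp.single_apply]

theorem repr_chartBasis_inr (Z : Fin m × Fin m → ℂ) (i j : Fin m) :
    b.repr (L.chartBasis hI b Z i) (Sum.inr j) = Z (i, j) := by
  simp [chartBasis, Finsupp.single_apply]

theorem linearIndependent_chartBasis (Z : Fin m × Fin m → ℂ) :
    LinearIndependent ℂ (L.chartBasis hI b Z) := by
  rw [Fintype.linearIndependent_iff]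
  intro c hc i
  rw [← L.repr_sum_chartBasis_inl hI (b := b) c Z i, hc]
  simp

/-- The subspace with matrix `Z` in the chart given by a basis `b`. -/
def chartSubspace (b : Module.Basis (Fin m ⊕ Fin m) ℂ (L.solutionSpace hI))
    (Z : Fin m × Fin m → ℂ) : Grassmannian m (L.solutionSpace hI) :=
  ⟨Submodule.span ℂ (Set.range (L.chartBasis hI b Z)), by
    rw [finrank_span_eq_card (L.linearIndependent_chartBasis hI Z), Fintype.card_fin]⟩

theorem chartSubspace_injective : Function.Injective (L.chartSubspace hI b) := by
  intro Z Z' h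
  have hspan : Submodule.span ℂ (Set.range (L.chartBasis hI b Z)) =
      Submodule.span ℂ (Set.range (L.chartBasis hI b Z')) := congrArg Subtype.val h
  ext ⟨i, j⟩
  have h1 : L.chartBasis hI b Z i ∈ Submodule.span ℂ (Set.range (L.chartBasis hI b Z')) :=
    hspan ▸ Submodule.subset_span ⟨i, rfl⟩
  obtain ⟨c, hc⟩ := (Submodule.mem_span_range_iff_exists_fun ℂ).1 h1
  have hci : c = Pi.single i 1 := by
    ext k
    rw [← L.repr_sum_chartBasis_inl hI (b := b) c Z' k, hc]
    have := L.repr_sum_chartBasis_inl hI (b := b) (Pi.single i 1) Z k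
    simpa [Pi.single_apply] using this
  rw [hci] at hc
  have h2 : L.chartBasis hI b Z' i = L.chartBasis hI b Z i := by
    simpa [Pi.single_apply] using hc
  rw [← L.repr_chartBasis_inr hI (b := b) Z, ← h2, L.repr_chartBasis_inr]

theorem wronskiMap_chartSubspace (hb : L.IsAdapted hI b t₀) (Z : Fin m × Fin m → ℂ) :
    wronskiMap I m (L.solutionSpace hI) (L.chartSubspace hI b Z) =
      Submodule.span ℂ {chartPoint (L.jetMatrix hI (b ∘ Sum.inl) t₀)
        (L.jetMatrix hI (b ∘ Sum.inl)) (L.jetMatrix hI (b ∘ Sum.inr)) Z} := by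
  rw [L.wronskiMap_eq_span hI _ (f := L.chartBasis hI b Z) rfl]
  have h1 : wronskian I (fun i => (L.chartBasis hI b Z i : ℝ → ℂ)) =
      (L.jetMatrix hI (b ∘ Sum.inl) t₀).det • chartPoint (L.jetMatrix hI (b ∘ Sum.inl) t₀)
        (L.jetMatrix hI (b ∘ Sum.inl)) (L.jetMatrix hI (b ∘ Sum.inr)) Z := by
    ext t
    have h2 := L.wronskian_linearCombination hI b 1 (Matrix.of fun i j => Z (i, j)) t
    rw [Pi.smul_apply, smul_eq_mul, chartPoint, mul_div_cancel₀ _ hb.det_ne_zero, ← one_mul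
      (L.jetMatrix hI (b ∘ Sum.inl) t), ← h2]
    congr 1
    ext i : 1
    simp [chartBasis, Matrix.one_apply]
  rw [h1]
  exact Submodule.span_singleton_smul_eq (isUnit_iff_ne_zero.2 hb.det_ne_zero) _

theorem jetMatrix_inr_eq_zero (hb : L.IsAdapted hI b t₀) :
    L.jetMatrix hI (b ∘ Sum.inr) t₀ = 0 := by
  ext i j
  exact congrFun (hb.jet_inr i) j

theorem chartPoint_self (hb : L.IsAdapted hI b t₀) (Z : Fin m × Fin m → ℂ) :
    chartPoint (L.jetMatrix hI (b ∘ Sum.inl) t₀)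
        (L.jetMatrix hI (b ∘ Sum.inl)) (L.jetMatrix hI (b ∘ Sum.inr)) Z t₀ = 1 := by
  rw [chartPoint, L.jetMatrix_inr_eq_zero hI hb, mul_zero, add_zero, div_self hb.det_ne_zero]

/-- A subspace whose Wronskian does not vanish at `t₀` lies in the chart. -/
theorem exists_eq_chartSubspace (hc : I.OrdConnected) (hb : L.IsAdapted hI b t₀)
    (H : Grassmannian m (L.solutionSpace hI)) {g : I → ℂ}
    (hg : g ∈ wronskiMap I m (L.solutionSpace hI) H) (hg0 : g t₀ ≠ 0) :
    ∃ Z, H = L.chartSubspace hI b Z := by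
  have := L.finiteDimensional_solutionSpace hI hc ⟨t₀, t₀.2⟩
  obtain ⟨f, hf, hfH⟩ := Submodule.exists_linearIndependent_span_eq H.1 H.2
  rw [L.wronskiMap_eq_span hI H hfH] at hg
  obtain ⟨c, rfl⟩ := Submodule.mem_span_singleton.1 hg
  let X : Matrix (Fin m) (Fin m) ℂ := Matrix.of fun i j => b.repr (f i) (Sum.inl j)
  let Y : Matrix (Fin m) (Fin m) ℂ := Matrix.of fun i j => b.repr (f i) (Sum.inr j)
  have hfXY : ∀ i, f i = ∑ j, X i j • b (Sum.inl j) + ∑ j, Y i j • b (Sum.inr j) := fun i => by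
    conv_lhs => rw [← b.sum_repr (f i), Fintype.sum_sum_type]
    rfl
  -- The `inr` vectors have zero `m`-jet at `t₀`, so the Wronskian there is `det X` times a
  -- constant.
  have hX : X.det ≠ 0 := by
    intro h
    refine hg0 ?_
    have h1 := L.wronskian_linearCombination hI b X Y t₀
    simp only [← hfXY] at h1
    rw [Pi.smul_apply, h1, L.jetMatrix_inr_eq_zero hI hb, mul_zero, add_zero, Matrix.det_mul, h,
      zero_mul, smul_zero]
  have hXi := Matrix.nonsing_inv_mul X (isUnit_iff_ne_zero.2 hX)
  refine ⟨fun p => (X⁻¹ * Y) p.1 p.2, Subtype.ext ?_⟩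
  have hchart : ∀ i, L.chartBasis hI b (fun p => (X⁻¹ * Y) p.1 p.2) i = ∑ k, X⁻¹ i k • f k := by
    intro i
    simp only [hfXY, smul_add, Finset.smul_sum, Finset.sum_add_distrib, smul_smul]
    rw [Finset.sum_comm, Finset.sum_comm (f := fun k j => (X⁻¹ i k * Y k j) • b (Sum.inr j))]
    simp only [← Finset.sum_smul, ← Matrix.mul_apply, hXi]
    simp [chartBasis, Matrix.one_apply]
  have hle : (L.chartSubspace hI b fun p => (X⁻¹ * Y) p.1 p.2).1 ≤ H.1 := by
    refine Submodule.span_le.2 ?_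
    rintro _ ⟨i, rfl⟩
    rw [hchart, ← hfH]
    exact Submodule.sum_mem _ fun k _ => Submodule.smul_mem _ _ (Submodule.subset_span ⟨k, rfl⟩)
  refine (Submodule.eq_of_le_of_finrank_eq hle ?_).symm
  rw [H.2, (L.chartSubspace hI b _).2]

/-- The homogenized polynomial is nonzero only on Wronskians not vanishing at `t₀`, so the fibres
concerned lie in the chart and are the fibres counted there. -/
theorem hasDegreeOverImage_wronskiMap (hm : 2 ≤ m) (hc : I.OrdConnected)
    (hb : L.IsAdapted hI b t₀) :
    ∃ d : ℕ, HasDegreeOverImage (wronskiMap I m (L.solutionSpace hI)) d ∧ Even d := by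
  set F := chartPoint (L.jetMatrix hI (b ∘ Sum.inl) t₀)
        (L.jetMatrix hI (b ∘ Sum.inl)) (L.jetMatrix hI (b ∘ Sum.inr)) with hF
  obtain ⟨Q, d, hd, ⟨Z₀, hZ₀⟩, hQ⟩ := exists_even_encard_chart_fibre hm
    (L.exists_det_ne_zero hI hc ⟨t₀, t₀.2⟩ b) hb.det_ne_zero (L.det_add_mul_symm hI hc hb)
  have hF1 : ∀ Z, F Z t₀ = 1 := L.chartPoint_self hI hb
  have hmap : ∀ Z, wronskiMap I m (L.solutionSpace hI) (L.chartSubspace hI b Z) =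
      Submodule.span ℂ {F Z} := L.wronskiMap_chartSubspace hI hb
  obtain ⟨P, D, hP, hP0, hPQ⟩ := exists_homogenization Q t₀
  refine ⟨d, ⟨P, D, hP, ⟨L.chartSubspace hI b Z₀, F Z₀, ?_, ?_⟩, ?_⟩, hd⟩
  · rw [hmap]
    exact Submodule.mem_span_singleton_self _
  · have := hPQ 1 (F Z₀) (hF1 Z₀)
    rw [one_smul, one_pow, one_mul] at this
    rwa [this]
  · rintro H ⟨g, hg, hgP⟩
    obtain ⟨Z, rfl⟩ := L.exists_eq_chartSubspace hI hc hb H hg fun h => hgP (hP0 g h)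
    rw [hmap] at hg
    obtain ⟨c, rfl⟩ := Submodule.mem_span_singleton.1 hg
    rw [hPQ c _ (hF1 Z)] at hgP
    rw [← hQ Z (right_ne_zero_of_mul hgP), ← (L.chartSubspace_injective hI (b := b)).encard_image]
    congr 1
    ext H'
    constructor
    · intro h
      have h : wronskiMap I m (L.solutionSpace hI) H' =
        wronskiMap I m (L.solutionSpace hI) (L.chartSubspace hI b Z) := h
      have hmem : F Z ∈ wronskiMap I m (L.solutionSpace hI) H' := by
        rw [h, hmap]
        exact Submodule.mem_span_singleton_self _
      obtain ⟨Z', rfl⟩ := L.exists_eq_chartSubspace hI hc hb H' hmem (by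
        rw [hF1]; exact one_ne_zero)
      refine ⟨Z', ?_, rfl⟩
      rw [hmap] at hmem
      obtain ⟨c', hc'⟩ := Submodule.mem_span_singleton.1 hmem
      -- Chart points take the value `1` at `t₀`, so equal lines have equal representatives.
      have h1 := congrFun hc' t₀
      rw [Pi.smul_apply, hF1, hF1, smul_eq_mul, mul_one] at h1
      rw [h1, one_smul] at hc'
      exact hc'
    · rintro ⟨Z', hZ', rfl⟩
      change wronskiMap I m (L.solutionSpace hI) _ = wronskiMap I m (L.solutionSpace hI) _
      rw [hmap, hmap, show F Z' = F Z from hZ']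

end LinDiffOp

end

theorem theorem2p8 (I : Set ℝ) (hI : IsOpen I) (hI_interval : I.OrdConnected)
    (hI_nonempty : I.Nonempty) (m : ℕ) (hm : 1 ≤ m) (L : LinDiffOp I (2 * m))
    (hL : L.EquivalentToAdjoint) :
    (∀ H : Grassmannian m (L.solutionSpace hI),
        Module.finrank ℂ (wronskiMap I m (L.solutionSpace hI) H) = 1) ∧
    (2 ≤ m → ∃ d : ℕ, HasDegreeOverImage (wronskiMap I m (L.solutionSpace hI)) d ∧ Even d) ∧
    Module.rank ℂ (wronskianSpan I m (L.solutionSpace hI)) ≤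
      (((2 * m).choose m - (if 2 ≤ m then (2 * m - 2).choose (m - 2) else 0) : ℕ) : Cardinal) := by
  obtain ⟨t₀, ht₀⟩ := hI_nonempty
  obtain ⟨b, hb⟩ := LinDiffOp.exists_isAdapted hI hm L hI_interval ⟨t₀, ht₀⟩ hL
  exact ⟨L.finrank_wronskiMap hI hI_interval ⟨t₀, ht₀⟩,
    fun h2 => L.hasDegreeOverImage_wronskiMap hI h2 hI_interval hb,
    L.rank_wronskianSpan_le hI hm hI_interval hb⟩
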